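/- Let $d\ge 1$ and let $f\in\mathbb R[x,y,z]$ be homogeneous of degree $d$ such that the complex projective plane curve $\mathcal V_{\mathbb C}(f)\subset\mathbb P^2(\mathbb C)$ is smooth (the gradient of $f$ vanishes at no point of $\mathcal V_{\mathbb C}(f)$). Suppose that $f=\det(M)$ with $M=xM_0+yM_1+zM_2$, where $M_0,M_1,M_2$ are Hermitian complex $d\times d$ matrices, and let $(a_{11},\dots,a_{1d})$ be the first row of the adjugate matrix $M^{\mathrm{adj}}$. For forms $g,h$ let $I_P(g,h)\in\mathbb N\cup\{\infty\}$ denote the intersection multiplicity at a point $P\in\mathbb P^2(\mathbb C)$. A divisor on $\mathcal V_{\mathbb C}(f)$ is a formal finite sum $D=\sum_i n_iP_i$ with $n_i\in\mathbb Z$ and $P_i\in\mathcal V_{\mathbb C}(f)$; its degree is $\sum_i n_i$ and its conjugate is $\overline D=\sum_i n_i\overline{P_i}$. If a form $g$ has no common factor with $f$, then $f.g=\sum_P I_P(f,g)\,P$. A divisor $D$ on $\mathcal V_{\mathbb C}(f)$ is a real-contact divisor if $f.g=D+\overline D$ for some real form $g$ having no common factor with $f$. For each $P\in\mathcal V_{\mathbb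 C}(a_{11},f)$ let $n_P=\min\{I_P(f,a_{1j})\mid j=1,\dots,d\}$. Then $a_{11}$ has no common factor with $f$, the set $\mathcal V_{\mathbb C}(a_{11},f)$ is finite, all $n_P$ are finite, and $$D_M=\sum_{P\in\mathcal V_{\mathbb C}(a_{11},f)} n_P\,P$$ is a real-contact divisor on $\mathcal V_{\mathbb C}(f)$ of degree $d(d-1)/2$ with $f.a_{11}=D_M+\overline{D_M}$. -/

import Mathlib

open MvPolynomial
open scoped LinearAlgebra.Projectivization ComplexConjugate

/-- Complex forms and polynomials in three variables `x, y, z` (`X 0`, `X 1`, `X 2`). -/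
abbrev CPoly : Type := MvPolynomial (Fin 3) ℂ

/-- Real polynomials in three variables. -/
abbrev RPoly : Type := MvPolynomial (Fin 3) ℝ

/-- A real polynomial viewed as a complex one. -/
noncomputable abbrev RPoly.toComplex (f : RPoly) : CPoly := MvPolynomial.map (algebraMap ℝ ℂ) f

/-- The complex projective plane. -/
abbrev CPlane : Type := ℙ ℂ (Fin 3 → ℂ)

/-- The homogeneous prime ideal of a point `P` of the plane: all polynomials that vanish
on the line through the origin in `ℂ³` which `P` is. -/
noncomputable def pointIdeal (P : CPlane) : Ideal CPoly :=
  vanishingIdeal ℂ (P.submodule : Set (Fin 3 → ℂ))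

lemma mem_pointIdeal_iff (P : CPlane) (h : CPoly) :
    h ∈ pointIdeal P ↔ ∀ v ∈ P.submodule, eval v h = 0 := by
  simp [pointIdeal, mem_vanishingIdeal_iff, aeval_eq_eval]

lemma pointIdeal_eq_ker (P : CPlane) :
    pointIdeal P = RingHom.ker
      (aeval (fun i => Polynomial.C (P.rep i) * Polynomial.X) : CPoly →ₐ[ℂ] Polynomial ℂ) := by
  have key : ∀ (h : CPoly) (t : ℂ),
      (aeval (fun i => Polynomial.C (P.rep i) * Polynomial.X) h : Polynomial ℂ).eval t
        = eval (t • P.rep) h := by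
    intro h t
    have : (Polynomial.aeval t).comp
        (aeval (fun i => Polynomial.C (P.rep i) * Polynomial.X) : CPoly →ₐ[ℂ] Polynomial ℂ)
          = aeval (t • P.rep) := by
      ext i
      simp only [AlgHom.comp_apply, aeval_X, map_mul, Polynomial.aeval_C, Polynomial.aeval_X]
      exact mul_comm _ _
    have h2 := DFunLike.congr_fun this h
    simpa [aeval_eq_eval, Polynomial.coe_aeval_eq_eval] using h2
  ext h
  rw [mem_pointIdeal_iff, RingHom.mem_ker]
  constructor
  · intro H
    apply Polynomial.funext
    intro t
    have := key h t
    rw [Polynomial.eval_zero]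
    refine this.trans (H _ ?_)
    rw [P.submodule_eq]
    exact Submodule.smul_mem _ _ (Submodule.mem_span_singleton_self _)
  · intro H v hv
    rw [P.submodule_eq] at hv
    obtain ⟨t, rfl⟩ := Submodule.mem_span_singleton.1 hv
    rw [← key h t]
    have H' : (aeval (fun i => Polynomial.C (P.rep i) * Polynomial.X) h : Polynomial ℂ) = 0 := H
    rw [H', Polynomial.eval_zero]

instance pointIdeal_isPrime (P : CPlane) : (pointIdeal P).IsPrime := by
  rw [pointIdeal_eq_ker]
  exact RingHom.ker_isPrime _

/-- The intersection multiplicity `I_P(f, g) ∈ ℕ ∪ {∞}` of two plane curves at a point `P`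
of the projective plane: with `S = ℂ[x,y,z]` and `𝔭` the homogeneous prime ideal of `P`, it is the
length of the `S_𝔭`-module `S_𝔭 / (f, g)`, i.e. of `(S/(f,g))_𝔭`. This is the textbook definition of
the intersection multiplicity through homogeneous coordinate rings. For forms `f`, `g` it is also
the dimension of `𝒪_P / (f_*, g_*)` over `ℂ`, where `𝒪_P ⊆ S_𝔭` is the local ring of the plane
at `P` and `f_*`, `g_*` are dehomogenizations, because `𝒪_P → S_𝔭` is flat and carries the maximal
ideal to the maximal ideal. It is `0` unless both curves pass through `P`, and `∞` if they share
a component through `P` (in particular if `g = 0` and `f` passes through `P`). -/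
noncomputable def intersectionMultiplicity (P : CPlane) (f g : CPoly) : ℕ∞ :=
  Module.length (Localization.AtPrime (pointIdeal P))
    (Localization.AtPrime (pointIdeal P) ⧸
      (Ideal.span {f, g}).map (algebraMap CPoly (Localization.AtPrime (pointIdeal P))))

/-- The set of complex points of the projective curve with equation `f = 0`. -/
def projectiveZeros (f : CPoly) : Set CPlane :=
  {P | ∀ v ∈ P.submodule, eval v f = 0}

/-- The complex projective curve `f = 0` is smooth: the gradient of `f` vanishes at no point
of the curve. -/
def IsSmoothCurve (f : CPoly) : Prop :=
  ∀ v : Fin 3 → ℂ, v ≠ 0 → eval v f = 0 → ∃ i, eval v (pderiv i f) ≠ 0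

/-- Divisors on the curve `f = 0`: the free abelian group over its complex points. -/
abbrev CurveDiv (f : CPoly) : Type := projectiveZeros f →₀ ℤ

/-- The degree of a divisor: the sum of its coefficients. -/
def CurveDiv.degree {f : CPoly} (D : CurveDiv f) : ℤ := D.sum fun _ n => n

/-- Complex conjugation `[a : b : c] ↦ [ā : b̄ : c̄]` on the projective plane. -/
noncomputable def conjPoint : CPlane → CPlane :=
  Projectivization.map (starLinearEquiv ℂ (A := Fin 3 → ℂ)).toLinearMap
    (starLinearEquiv ℂ (A := Fin 3 → ℂ)).injective

lemma conjPoint_mk (v : Fin 3 → ℂ) (hv : v ≠ 0) :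
    conjPoint (Projectivization.mk ℂ v hv) =
      Projectivization.mk ℂ (fun i => conj (v i)) (fun h => hv (by
        funext i; simpa using congrFun h i)) := by
  rfl

lemma eval_conj_toComplex (f : RPoly) (v : Fin 3 → ℂ) :
    eval (fun i => conj (v i)) f.toComplex = conj (eval v f.toComplex) := by
  induction f using MvPolynomial.induction_on with
  | C a => simp
  | add p q hp hq => simpa using congrArg₂ (· + ·) hp hq
  | mul_X p i hp => simpa using congrArg (· * conj (v i)) hp

/-- The complex points of a real curve are stable under conjugation. -/
lemma conjPoint_mem (f : RPoly) {P : CPlane} (hP : P ∈ projectiveZeros f.toComplex) :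
    conjPoint P ∈ projectiveZeros f.toComplex := by
  induction P using Projectivization.ind with
  | h v hv =>
    intro w hw
    rw [conjPoint_mk, Projectivization.submodule_mk] at hw
    obtain ⟨t, rfl⟩ := Submodule.mem_span_singleton.1 hw
    have h1 := hP (conj t • v) (by
      rw [Projectivization.submodule_mk]
      exact Submodule.smul_mem _ _ (Submodule.mem_span_singleton_self _))
    have h2 := eval_conj_toComplex f (conj t • v)
    rw [h1, map_zero] at h2
    rw [← h2]
    congr 2
    funext i
    simp

/-- The conjugate divisor `D̄ = ∑ nᵢ P̄ᵢ` of a divisor `D = ∑ nᵢ Pᵢ` on a real curve. -/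
noncomputable def CurveDiv.conjugate {f : RPoly} (D : CurveDiv f.toComplex) :
    CurveDiv f.toComplex :=
  Finsupp.mapDomain (fun P => ⟨conjPoint P.1, conjPoint_mem f P.2⟩) D

/-- `f.g = E`: the polynomials `f` and `g` share no factors and the divisor `E` on the curve `f = 0`
is the intersection divisor of `f` and `g`, i.e. its coefficient at every point `P`
is the (finite) intersection multiplicity `I_P(f, g)`. -/
def IsIntersectionDivisor (f g : CPoly) (E : CurveDiv f) : Prop :=
  IsRelPrime f g ∧
    ∀ P : projectiveZeros f, ∃ n : ℕ, intersectionMultiplicity P.1 f g = n ∧ E P = n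

/-- A divisor `D` on the real curve `f = 0` is a real-contact divisor: there is a real form `g`
with `f.g = D + D̄`. -/
def IsRealContactDivisor (f : RPoly) (D : CurveDiv f.toComplex) : Prop :=
  ∃ (g : RPoly) (e : ℕ), g.IsHomogeneous e ∧
    IsIntersectionDivisor f.toComplex g.toComplex (D + D.conjugate)

/-- The matrix of linear forms `x M₀ + y M₁ + z M₂`. -/
noncomputable def linearPencil {d : ℕ} (M : Fin 3 → Matrix (Fin d) (Fin d) ℂ) :
    Matrix (Fin d) (Fin d) CPoly :=
  ∑ i, (X i : CPoly) • (M i).map C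

/-- `f = det (x M₀ + y M₁ + z M₂)` with Hermitian matrices `M₀, M₁, M₂` of size `d`. -/
def IsHermitianRepresentation {d : ℕ} (f : RPoly) (M : Fin 3 → Matrix (Fin d) (Fin d) ℂ) : Prop :=
  (∀ i, (M i).IsHermitian) ∧ f.toComplex = (linearPencil M).det

/-- The first row `(a₁₁, …, a₁d)` of the adjugate of `x M₀ + y M₁ + z M₂`
(so `a₁₁` has index `0`). -/
noncomputable def adjFirstRow {d : ℕ} [NeZero d] (M : Fin 3 → Matrix (Fin d) (Fin d) ℂ)
    (j : Fin d) : CPoly :=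
  (linearPencil M).adjugate 0 j

/-- `D = ∑ n_P P`, the sum over the common points `P` of `a₁₁` and `f`, where `n_P` is the minimum
over `j` of the intersection multiplicities `I_P(f, a₁ⱼ)` (and this minimum is finite). The
coefficients determine `D` uniquely. -/
def IsMinorDivisor {d : ℕ} [NeZero d] (f : CPoly) (M : Fin 3 → Matrix (Fin d) (Fin d) ℂ)
    (D : CurveDiv f) : Prop :=
  ∀ P : projectiveZeros f,
    (P.1 ∈ projectiveZeros (adjFirstRow M 0) →
      ∃ n : ℕ, (⨅ j, intersectionMultiplicity P.1 f (adjFirstRow M j)) = n ∧ D P = n) ∧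
    (P.1 ∉ projectiveZeros (adjFirstRow M 0) → D P = 0)

/-! Write `a` for the adjugate of the pencil, indexed from `0`. The 2×2 minors of `a` are divisible
by `f = det` (`dvd_adjugate_mul_sub`), so modulo `f` one has `a 0 j * a k 0 = a 0 0 * a k j`.
Smoothness makes the local ring of the curve at a point `P` a discrete valuation ring whose
valuation `v` is `I_P(f, ·)`. It also forces some entry `a k j` to be nonzero at `P`
(`exists_eval_adjugate_ne_zero`). For that entry `v (a 0 j) + v (a k 0) = v (a 0 0)`, and the same
relation shows that both summands are minimal, in the first row and in the first column
(`orderAt_adjFirstRow_zero`).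

Since the matrices are Hermitian, conjugating coefficients transposes `a`, so the column minimum at
`P` is the row minimum at the conjugate point. Hence `f.a₁₁ = D + D̄`. As `a₁₁` is a real form of
degree `d - 1`, Bézout's theorem gives `2 deg D = d (d - 1)`.

Bézout's theorem comes from computing the codimension of one space of forms of large degree `n`
twice. The degree `n` part of `(f, g)` has codimension `d * e` by inclusion–exclusion. By Max
Noether's theorem (`exists_forall_mem_of_orderAt_le`) it consists of the forms vanishing on the
intersection divisor, and each point of that divisor, counted with multiplicity, imposes one
condition. -/

/-! ### Local rings of curves at nonsingular points, and the order of vanishing. -/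

section LocalCurve

variable {A : Type*} [CommRing A] (p : Ideal A) [p.IsPrime] (f : A)

/-- The local ring at `p` of the closed subscheme `f = 0` of `Spec A`. -/
abbrev LocalCurve : Type _ :=
  Localization.AtPrime p ⧸ Ideal.span {algebraMap A (Localization.AtPrime p) f}

variable {p f}

/-- A denominator outside `p` is not divisible by `f ∈ p`, so primality of `f` removes it. -/
lemma localCurve_mk_eq_zero_iff [IsDomain A] (hf : Prime f) (hfp : f ∈ p) (a : A) :
    algebraMap A (LocalCurve p f) a = 0 ↔ f ∣ a := by
  rw [IsScalarTower.algebraMap_apply A (Localization.AtPrime p) (LocalCurve p f),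
    Ideal.Quotient.algebraMap_eq, Ideal.Quotient.eq_zero_iff_mem, ← Set.image_singleton,
    ← Ideal.map_span, IsLocalization.algebraMap_mem_map_algebraMap_iff p.primeCompl]
  simp only [Ideal.mem_span_singleton]
  constructor
  · rintro ⟨m, hm, h⟩
    exact (hf.dvd_or_dvd h).resolve_left fun h' => hm (p.mem_of_dvd h' hfp)
  · exact fun h => ⟨1, p.primeCompl.one_mem, by simpa using h⟩

lemma isUnit_localCurve_iff (hfp : f ∈ p) (a : A) :
    IsUnit (algebraMap A (LocalCurve p f) a) ↔ a ∉ p := by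
  have hle : Ideal.span {algebraMap A (Localization.AtPrime p) f} ≤
      IsLocalRing.maximalIdeal _ := by
    rw [Ideal.span_singleton_le_iff_mem, IsLocalization.AtPrime.to_map_mem_maximal_iff _ p]
    exact hfp
  have hne : Ideal.span {algebraMap A (Localization.AtPrime p) f} ≠ ⊤ :=
    fun h => (IsLocalRing.maximalIdeal.isMaximal _).ne_top (top_le_iff.1 (h ▸ hle))
  have : Nontrivial (LocalCurve p f) := Ideal.Quotient.nontrivial_iff.2 hne
  have : IsLocalHom (Ideal.Quotient.mk
      (Ideal.span {algebraMap A (Localization.AtPrime p) f})) :=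
    IsLocalHom.of_surjective _ Ideal.Quotient.mk_surjective
  rw [IsScalarTower.algebraMap_apply A (Localization.AtPrime p) (LocalCurve p f),
    Ideal.Quotient.algebraMap_eq, isUnit_map_iff, IsLocalization.AtPrime.isUnit_to_map_iff _ p]
  rfl

lemma exists_localCurve_eq (x : LocalCurve p f) :
    ∃ a, ∃ s ∉ p, algebraMap A (LocalCurve p f) s * x = algebraMap A (LocalCurve p f) a := by
  obtain ⟨y, rfl⟩ := Ideal.Quotient.mk_surjective x
  obtain ⟨⟨a, s⟩, h⟩ := IsLocalization.surj p.primeCompl y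
  refine ⟨a, s, s.2, ?_⟩
  rw [IsScalarTower.algebraMap_apply A (Localization.AtPrime p) (LocalCurve p f),
    IsScalarTower.algebraMap_apply A (Localization.AtPrime p) (LocalCurve p f) a, ← h,
    map_mul, mul_comm]
  rfl

lemma isDomain_localCurve [IsDomain A] (hf : Prime f) (hfp : f ∈ p) :
    IsDomain (LocalCurve p f) := by
  have : Nontrivial (LocalCurve p f) := by
    refine ⟨1, 0, fun h => hf.not_isUnit ?_⟩
    rw [← map_one (algebraMap A (LocalCurve p f)), localCurve_mk_eq_zero_iff hf hfp] at h
    exact isUnit_of_dvd_one h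
  have : NoZeroDivisors (LocalCurve p f) := by
    refine ⟨fun {x y} hxy => ?_⟩
    obtain ⟨a, s, hs, hx⟩ := exists_localCurve_eq x
    obtain ⟨b, t, ht, hy⟩ := exists_localCurve_eq y
    have h : f ∣ a * b := by
      rw [← localCurve_mk_eq_zero_iff hf hfp, map_mul, ← hx, ← hy]
      linear_combination (algebraMap A (LocalCurve p f) s * algebraMap A (LocalCurve p f) t) * hxy
    refine (hf.dvd_or_dvd h).imp (fun h => ?_) (fun h => ?_)
    · rw [← localCurve_mk_eq_zero_iff hf hfp, ← hx] at h
      exact ((isUnit_localCurve_iff hfp s).2 hs).mul_right_eq_zero.1 h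
    · rw [← localCurve_mk_eq_zero_iff hf hfp, ← hy] at h
      exact ((isUnit_localCurve_iff hfp t).2 ht).mul_right_eq_zero.1 h
  exact NoZeroDivisors.to_isDomain _

variable (p f) in
/-- `t` generates the maximal ideal of the integral curve `f = 0` at its nonsingular point `p`. -/
structure IsUniformizerAt (t : A) : Prop where
  prime : Prime f
  mem : f ∈ p
  mem_point : t ∈ p
  not_dvd : ¬ f ∣ t
  -- Denominator-free form of "`f` and `t` generate `p` after localizing".
  exists_mul_mem : ∃ s ∉ p, ∀ a ∈ p, s * a ∈ Ideal.span {f, t}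

variable {t : A}

lemma IsUniformizerAt.maximalIdeal [IsDomain A] [IsLocalRing (LocalCurve p f)]
    (ht : IsUniformizerAt p f t) :
    IsLocalRing.maximalIdeal (LocalCurve p f) =
      Ideal.span {algebraMap A (LocalCurve p f) t} := by
  apply le_antisymm
  · intro x hx
    obtain ⟨a, s, hs, h⟩ := exists_localCurve_eq x
    obtain ⟨s', hs', H⟩ := ht.exists_mul_mem
    have ha : a ∈ p := by
      by_contra ha
      rw [← isUnit_localCurve_iff ht.mem, ← h] at ha
      exact (IsLocalRing.mem_maximalIdeal _).1 hx (isUnit_of_mul_isUnit_right ha)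
    obtain ⟨b, c, hbc⟩ := Ideal.mem_span_pair.1 (H a ha)
    rw [Ideal.mem_span_singleton]
    rw [← ((isUnit_localCurve_iff ht.mem s).2 hs).dvd_mul_left,
      ← ((isUnit_localCurve_iff ht.mem s').2 hs').dvd_mul_left, h, ← map_mul, ← hbc, map_add,
      map_mul, map_mul, (localCurve_mk_eq_zero_iff ht.prime ht.mem f).2 dvd_rfl]
    simp
  · rw [Ideal.span_singleton_le_iff_mem, IsLocalRing.mem_maximalIdeal, mem_nonunits_iff,
      isUnit_localCurve_iff ht.mem, not_not]
    exact ht.mem_point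

lemma IsUniformizerAt.isDiscreteValuationRing [IsNoetherianRing A] [IsDomain A]
    [IsDomain (LocalCurve p f)] (ht : IsUniformizerAt p f t) :
    IsDiscreteValuationRing (LocalCurve p f) := by
  have : IsNoetherianRing (Localization.AtPrime p) :=
    IsLocalization.isNoetherianRing p.primeCompl _ inferInstance
  have : IsLocalRing (LocalCurve p f) :=
    IsLocalRing.of_surjective' _ Ideal.Quotient.mk_surjective
  have hfield : ¬ IsField (LocalCurve p f) := by
    rw [IsLocalRing.isField_iff_maximalIdeal_eq, ht.maximalIdeal, Ideal.span_singleton_eq_bot,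
      localCurve_mk_eq_zero_iff ht.prime ht.mem]
    exact ht.not_dvd
  -- Item 4 is principality of the maximal ideal.
  refine ((IsDiscreteValuationRing.TFAE (LocalCurve p f) hfield).out 0 4).2 ?_
  rw [ht.maximalIdeal]
  exact ⟨⟨_, rfl⟩⟩

variable (p f) in
/-- The length of `A_p / (f, g)`. -/
noncomputable def orderAt (g : A) : ℕ∞ :=
  Module.length (Localization.AtPrime p)
    (Localization.AtPrime p ⧸
      (Ideal.span {f, g}).map (algebraMap A (Localization.AtPrime p)))

/-- Third isomorphism theorem; length is unchanged when scalars are restricted along a surjection.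
At `pointIdeal P`, `orderAt` is `intersectionMultiplicity P` by definition. -/
lemma orderAt_eq_ord (g : A) :
    orderAt p f g = Ring.ord (LocalCurve p f) (algebraMap A (LocalCurve p f) g) := by
  set I := Ideal.span {algebraMap A (Localization.AtPrime p) f}
  set J := Ideal.span {algebraMap A (Localization.AtPrime p) g}
  have e : (Ideal.span {f, g}).map (algebraMap A (Localization.AtPrime p)) = I ⊔ J := by
    rw [Ideal.map_span, Set.image_pair, Ideal.span_insert]
  have e' : Ideal.span {algebraMap A (LocalCurve p f) g} = J.map (Ideal.Quotient.mk I) := by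
    rw [Ideal.map_span, Set.image_singleton]; rfl
  rw [orderAt, Ring.ord, e, e', ← Module.length_eq_of_surjective
    (S := Localization.AtPrime p) (R := LocalCurve p f) Ideal.Quotient.mk_surjective]
  exact (DoubleQuot.quotQuotEquivQuotSupₐ (Localization.AtPrime p) I J).toLinearEquiv.length_eq.symm

lemma orderAt_eq_addVal [IsDomain (LocalCurve p f)]
    [IsDiscreteValuationRing (LocalCurve p f)] (g : A) :
    orderAt p f g =
      IsDiscreteValuationRing.addVal (LocalCurve p f) (algebraMap A (LocalCurve p f) g) := by
  rw [orderAt_eq_ord, Ring.ord_eq_addVal]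

variable [IsNoetherianRing A] [IsDomain A]

lemma IsUniformizerAt.orderAt_mul (ht : IsUniformizerAt p f t) (a b : A) :
    orderAt p f (a * b) = orderAt p f a + orderAt p f b := by
  have := isDomain_localCurve ht.prime ht.mem
  have := ht.isDiscreteValuationRing
  simp only [orderAt_eq_addVal, map_mul, IsDiscreteValuationRing.addVal_mul]

lemma IsUniformizerAt.le_orderAt_add (ht : IsUniformizerAt p f t) {a b : A} {n : ℕ∞}
    (ha : n ≤ orderAt p f a) (hb : n ≤ orderAt p f b) : n ≤ orderAt p f (a + b) := by
  have := isDomain_localCurve ht.prime ht.mem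
  have := ht.isDiscreteValuationRing
  simp only [orderAt_eq_addVal, map_add] at *
  exact (le_min ha hb).trans IsDiscreteValuationRing.addVal_add

lemma IsUniformizerAt.orderAt_eq_zero_iff (ht : IsUniformizerAt p f t) {a : A} :
    orderAt p f a = 0 ↔ a ∉ p := by
  have := isDomain_localCurve ht.prime ht.mem
  have := ht.isDiscreteValuationRing
  rw [orderAt_eq_addVal, IsDiscreteValuationRing.addVal_eq_zero_iff,
    isUnit_localCurve_iff ht.mem]

lemma IsUniformizerAt.orderAt_eq_top_iff (ht : IsUniformizerAt p f t) {a : A} :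
    orderAt p f a = ⊤ ↔ f ∣ a := by
  have := isDomain_localCurve ht.prime ht.mem
  have := ht.isDiscreteValuationRing
  rw [orderAt_eq_addVal, IsDiscreteValuationRing.addVal_eq_top_iff,
    localCurve_mk_eq_zero_iff ht.prime ht.mem]

lemma IsUniformizerAt.orderAt_self (ht : IsUniformizerAt p f t) : orderAt p f t = 1 := by
  have := isDomain_localCurve ht.prime ht.mem
  have := ht.isDiscreteValuationRing
  rw [orderAt_eq_addVal]
  exact IsDiscreteValuationRing.addVal_uniformizer
    ((IsDiscreteValuationRing.irreducible_iff_uniformizer _).2 ht.maximalIdeal)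

/-- In a valuation ring, comparing orders is divisibility; clearing denominators turns it into a
statement about `A` alone, where homogeneity and ring isomorphisms can be used. -/
lemma IsUniformizerAt.orderAt_le_iff (ht : IsUniformizerAt p f t) {a b : A} :
    orderAt p f a ≤ orderAt p f b ↔ ∃ s ∉ p, ∃ r, f ∣ s * b - r * a := by
  have := isDomain_localCurve ht.prime ht.mem
  have := ht.isDiscreteValuationRing
  rw [orderAt_eq_addVal, orderAt_eq_addVal,
    IsDiscreteValuationRing.addVal_le_iff_dvd]
  constructor
  · rintro ⟨x, hx⟩
    obtain ⟨r, s, hs, h⟩ := exists_localCurve_eq x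
    refine ⟨s, hs, r, ?_⟩
    rw [← localCurve_mk_eq_zero_iff ht.prime ht.mem (p := p), map_sub, map_mul, map_mul, hx, ← h]
    ring
  · rintro ⟨s, hs, r, h⟩
    rw [← localCurve_mk_eq_zero_iff ht.prime ht.mem (p := p), map_sub, map_mul, map_mul,
      sub_eq_zero] at h
    rw [← ((isUnit_localCurve_iff ht.mem s).2 hs).dvd_mul_left, h]
    exact dvd_mul_left _ _

lemma IsUniformizerAt.orderAt_pow (ht : IsUniformizerAt p f t) (n : ℕ) :
    orderAt p f (t ^ n) = n := by
  induction n with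
  | zero => rw [pow_zero, Nat.cast_zero, ht.orderAt_eq_zero_iff]
            exact fun h => (inferInstance : p.IsPrime).one_notMem h
  | succ n ih => rw [pow_succ, ht.orderAt_mul, ih, ht.orderAt_self, Nat.cast_succ]

end LocalCurve

/-! ### Invariance of the order under ring isomorphisms. -/

section Transport

variable {A B : Type*} [CommRing A] [CommRing B] {p : Ideal A} {q : Ideal B} {f t : A}

lemma IsUniformizerAt.map_ringEquiv (ht : IsUniformizerAt p f t) (e : A ≃+* B)
    (he : ∀ a, e a ∈ q ↔ a ∈ p) : IsUniformizerAt q (e f) (e t) where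
  prime := (MulEquiv.prime_iff e).2 ht.prime
  mem := (he f).2 ht.mem
  mem_point := (he t).2 ht.mem_point
  not_dvd := by rw [map_dvd_iff]; exact ht.not_dvd
  exists_mul_mem := by
    obtain ⟨s, hs, H⟩ := ht.exists_mul_mem
    refine ⟨e s, mt (he s).1 hs, fun b hb => ?_⟩
    obtain ⟨a, rfl⟩ := e.surjective b
    obtain ⟨x, y, hxy⟩ := Ideal.mem_span_pair.1 (H a ((he a).1 hb))
    exact Ideal.mem_span_pair.2 ⟨e x, e y, by simp only [← map_mul, ← map_add, hxy]⟩

variable [p.IsPrime] [q.IsPrime] [IsNoetherianRing A] [IsDomain A] [IsNoetherianRing B] [IsDomain B]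

/-- A finite order is determined by comparison with powers of `t`, and comparisons are
divisibilities in the ring, which `e` preserves. -/
lemma IsUniformizerAt.orderAt_map_ringEquiv (ht : IsUniformizerAt p f t) (e : A ≃+* B)
    (he : ∀ a, e a ∈ q ↔ a ∈ p) (g : A) : orderAt q (e f) (e g) = orderAt p f g := by
  have ht' := ht.map_ringEquiv e he
  have key : ∀ a b, orderAt p f a ≤ orderAt p f b ↔
      orderAt q (e f) (e a) ≤ orderAt q (e f) (e b) := by
    intro a b
    rw [ht.orderAt_le_iff, ht'.orderAt_le_iff]
    constructor
    · rintro ⟨s, hs, r, h⟩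
      exact ⟨e s, mt (he s).1 hs, e r, by simpa only [map_mul, map_sub] using map_dvd e h⟩
    · rintro ⟨s, hs, r, h⟩
      obtain ⟨s, rfl⟩ := e.surjective s
      obtain ⟨r, rfl⟩ := e.surjective r
      refine ⟨s, mt (he s).2 hs, r, ?_⟩
      rwa [← map_mul, ← map_mul, ← map_sub, map_dvd_iff] at h
  by_cases h : f ∣ g
  · rw [ht.orderAt_eq_top_iff.2 h, ht'.orderAt_eq_top_iff.2 (map_dvd e h)]
  · obtain ⟨n, hn⟩ := ENat.ne_top_iff_exists.1 (mt ht.orderAt_eq_top_iff.1 h)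
    have h1 := (key g (t ^ n)).1 (by rw [ht.orderAt_pow, hn])
    have h2 := (key (t ^ n) g).1 (by rw [ht.orderAt_pow, hn])
    rw [map_pow, ht'.orderAt_pow] at h1 h2
    rw [← hn]
    exact le_antisymm h1 h2

end Transport

/-! ### Ideals of points, linear uniformizers, finiteness of intersections. -/

section Points

lemma eval_smul_of_isHomogeneous {h : CPoly} {n : ℕ} (hh : h.IsHomogeneous n) (c : ℂ)
    (v : Fin 3 → ℂ) : eval (c • v) h = c ^ n * eval v h := by
  rw [eval_eq, eval_eq, Finset.mul_sum]
  refine Finset.sum_congr rfl fun x hx => ?_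
  have : ∑ i ∈ x.support, x i = n := (hh.degree_eq_sum_deg_support hx).symm
  simp only [Pi.smul_apply, smul_eq_mul, mul_pow, Finset.prod_mul_distrib,
    Finset.prod_pow_eq_pow_sum, this]
  ring

lemma mem_pointIdeal_iff_of_isHomogeneous {P : CPlane} {h : CPoly} {n : ℕ}
    (hh : h.IsHomogeneous n) {v : Fin 3 → ℂ} (hv : v ≠ 0) (hvP : v ∈ P.submodule) :
    h ∈ pointIdeal P ↔ eval v h = 0 := by
  rw [mem_pointIdeal_iff]
  refine ⟨fun H => H v hvP, fun H w hw => ?_⟩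
  rw [P.submodule_eq] at hvP hw
  obtain ⟨a, rfl⟩ := Submodule.mem_span_singleton.1 hvP
  obtain ⟨b, rfl⟩ := Submodule.mem_span_singleton.1 hw
  have ha : a ≠ 0 := fun h => hv (by rw [h, zero_smul])
  rw [eval_smul_of_isHomogeneous hh] at H ⊢
  rw [(mul_eq_zero.1 H).resolve_left (pow_ne_zero _ ha), mul_zero]

lemma rep_mem_submodule (P : CPlane) : P.rep ∈ P.submodule := by
  rw [P.submodule_eq]; exact Submodule.mem_span_singleton_self _

lemma mem_pointIdeal_iff_eval_rep {P : CPlane} {h : CPoly} {n : ℕ} (hh : h.IsHomogeneous n) :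
    h ∈ pointIdeal P ↔ eval P.rep h = 0 :=
  mem_pointIdeal_iff_of_isHomogeneous hh P.rep_nonzero (rep_mem_submodule P)

lemma mem_projectiveZeros_iff {f : CPoly} {P : CPlane} :
    P ∈ projectiveZeros f ↔ f ∈ pointIdeal P := (mem_pointIdeal_iff P f).symm

lemma exists_homogeneousComponent_notMem {P : CPlane} {s : CPoly} (hs : s ∉ pointIdeal P) :
    ∃ m, homogeneousComponent m s ∉ pointIdeal P := by
  by_contra! h
  exact hs (sum_homogeneousComponent s ▸ Ideal.sum_mem _ fun i _ => h i)

/-- The linear forms `xᵢ - (vᵢ / vₖ) xₖ`. -/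
noncomputable def pointForm (v : Fin 3 → ℂ) (k i : Fin 3) : CPoly := X i - C (v i / v k) * X k

lemma pointForm_isHomogeneous (v : Fin 3 → ℂ) (k i : Fin 3) :
    (pointForm v k i).IsHomogeneous 1 :=
  (isHomogeneous_X _ _).sub (isHomogeneous_C_mul_X _ _)

lemma pointForm_self {v : Fin 3 → ℂ} {k : Fin 3} (hk : v k ≠ 0) : pointForm v k k = 0 := by
  simp [pointForm, hk]

lemma eval_pointForm {v : Fin 3 → ℂ} {k : Fin 3} (hk : v k ≠ 0) (i : Fin 3) :
    eval v (pointForm v k i) = 0 := by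
  simp [pointForm, hk]

/-- Modulo these linear forms, `h` equals its restriction to the line `P`, rewritten as a polynomial
in `X k`; membership in `pointIdeal P` says that this restriction is zero. -/
lemma pointIdeal_eq_span (P : CPlane) {k : Fin 3} (hk : P.rep k ≠ 0) :
    pointIdeal P = Ideal.span (Set.range (pointForm P.rep k)) := by
  apply le_antisymm
  · intro h hh
    set I := Ideal.span (Set.range (pointForm P.rep k))
    rw [pointIdeal_eq_ker, RingHom.mem_ker] at hh
    let φ : CPoly →ₐ[ℂ] CPoly := (Polynomial.aeval (C (P.rep k)⁻¹ * X k)).comp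
      (aeval (fun i => Polynomial.C (P.rep i) * Polynomial.X))
    have hφ : (Ideal.Quotient.mkₐ ℂ I).comp φ = Ideal.Quotient.mkₐ ℂ I := by
      ext i
      simp only [φ, AlgHom.comp_apply, aeval_X, map_mul, Polynomial.aeval_C, Polynomial.aeval_X,
        Ideal.Quotient.mkₐ_eq_mk]
      rw [eq_comm, ← map_mul, ← map_mul, Ideal.Quotient.mk_eq_mk_iff_sub_mem]
      refine Ideal.subset_span ⟨i, ?_⟩
      rw [pointForm, div_eq_mul_inv, C_mul, algebraMap_eq, mul_assoc]
    have := DFunLike.congr_fun hφ h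
    have h0 : φ h = 0 := by
      simp only [φ, AlgHom.comp_apply]
      exact (congrArg _ hh).trans (map_zero _)
    rw [AlgHom.comp_apply, h0, map_zero] at this
    exact Ideal.Quotient.eq_zero_iff_mem.1 this.symm
  · rw [Ideal.span_le]
    rintro _ ⟨i, rfl⟩
    exact (mem_pointIdeal_iff_eval_rep (pointForm_isHomogeneous _ _ _)).2 (eval_pointForm hk i)

lemma mem_submodule_of_forall_mem_pointIdeal {P : CPlane} {w : Fin 3 → ℂ}
    (H : ∀ a ∈ pointIdeal P, eval w a = 0) : w ∈ P.submodule := by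
  obtain ⟨k, hk⟩ := Function.ne_iff.1 P.rep_nonzero
  rw [P.submodule_eq, Submodule.mem_span_singleton]
  refine ⟨w k / P.rep k, funext fun i => ?_⟩
  have := H (pointForm P.rep k i) (by
    rw [pointIdeal_eq_span P hk]; exact Ideal.subset_span ⟨i, rfl⟩)
  simp only [pointForm, map_sub, map_mul, eval_X, eval_C, sub_eq_zero] at this
  rw [this, Pi.smul_apply, smul_eq_mul]
  ring

lemma pointIdeal_injective : Function.Injective pointIdeal := by
  have key : ∀ P Q : CPlane, pointIdeal P = pointIdeal Q → Q.submodule ≤ P.submodule :=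
    fun P Q h w hw => mem_submodule_of_forall_mem_pointIdeal fun a ha =>
      (mem_pointIdeal_iff Q a).1 (h ▸ ha) w hw
  exact fun P Q h => Projectivization.submodule_injective
    (le_antisymm (key Q P h.symm) (key P Q h))

lemma exists_pair_of_ne (k i : Fin 3) (h : i ≠ k) :
    ∃ j, j ≠ k ∧ j ≠ i ∧ (Finset.univ : Finset (Fin 3)) = {k, i, j} := by
  revert k i; decide

lemma pointIdeal_eq_span_pair (P : CPlane) {k i j : Fin 3} (hk : P.rep k ≠ 0)
    (h : (Finset.univ : Finset (Fin 3)) = {k, i, j}) :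
    pointIdeal P = Ideal.span {pointForm P.rep k i, pointForm P.rep k j} := by
  have hr : Set.range (pointForm P.rep k) =
      {0, pointForm P.rep k i, pointForm P.rep k j} := by
    rw [← Set.image_univ, ← Finset.coe_univ, h]
    simp [Set.image_insert_eq, pointForm_self hk]
  rw [pointIdeal_eq_span P hk, hr, Ideal.span_insert_zero]

lemma height_pointIdeal_le (P : CPlane) : (pointIdeal P).height ≤ 2 := by
  obtain ⟨k, hk⟩ := Function.ne_iff.1 P.rep_nonzero
  obtain ⟨i, hi⟩ := exists_ne k
  obtain ⟨j, -, -, h⟩ := exists_pair_of_ne k i hi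
  have hp := pointIdeal_eq_span_pair P hk h
  refine (Ideal.height_le_card_of_mem_minimalPrimes_span
    (s := {pointForm P.rep k i, pointForm P.rep k j}) (Set.toFinite _) ?_).trans ?_
  · rw [← hp, Ideal.minimalPrimes_eq_subsingleton_self]; rfl
  · exact_mod_cast (Set.ncard_insert_le _ _).trans (by rw [Set.ncard_singleton])

/-- A smooth curve has a linear form as a uniformizer at each of its points. -/
lemma exists_isUniformizerAt {f : CPoly} (hf : Prime f) (hs : IsSmoothCurve f) {P : CPlane}
    (hP : f ∈ pointIdeal P) :
    ∃ t : CPoly, t.IsHomogeneous 1 ∧ IsUniformizerAt (pointIdeal P) f t := by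
  obtain ⟨k, hk⟩ := Function.ne_iff.1 P.rep_nonzero
  have hk : P.rep k ≠ 0 := hk
  set v := P.rep with hv
  have hev : ∀ i, eval v (pointForm v k i) = 0 := eval_pointForm hk
  have hd : ∀ (a : CPoly) (i l : Fin 3), eval v (pderiv l (a * pointForm v k i)) =
      eval v a * (if i = l then 1 else 0) - eval v a * (v i / v k) * (if k = l then 1 else 0) := by
    intro a i l
    rw [Derivation.leibniz, map_add, smul_eq_mul, smul_eq_mul, map_mul, map_mul, hev, zero_mul,
      add_zero, pointForm, map_sub, pderiv_C_mul, pderiv_X, pderiv_X, Pi.single_apply,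
      Pi.single_apply]
    split_ifs <;> simp [mul_sub]
  have hfs := hP
  rw [pointIdeal_eq_span P hk, Ideal.mem_span_range_iff_exists_fun] at hfs
  obtain ⟨a, ha⟩ := hfs
  -- In `f = ∑ a i * ℓ i` with `ℓ i` vanishing at `v`, the gradient at `v` depends only on the
  -- values `a i` at `v`, so smoothness makes one with `i ≠ k` nonzero. Inverting it expresses `ℓ i`
  -- through `f` and the remaining form `ℓ j`, which is therefore the uniformizer.
  obtain ⟨i, hik, hai⟩ : ∃ i, i ≠ k ∧ eval v (a i) ≠ 0 := by
    by_contra! H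
    obtain ⟨l, hl⟩ := hs v P.rep_nonzero
      ((mem_pointIdeal_iff P f).1 hP v (rep_mem_submodule P))
    refine hl ?_
    rw [← ha, map_sum, map_sum]
    refine Finset.sum_eq_zero fun i _ => ?_
    by_cases hi : i = k
    · subst hi; rw [← hv, pointForm_self hk]; simp
    · rw [hd, H i hi]; simp
  obtain ⟨j, hjk, hji, huniv⟩ := exists_pair_of_ne k i hik
  have ha2 : f = a i * pointForm v k i + a j * pointForm v k j := by
    rw [← ha, huniv, Finset.sum_insert (by simp [hik.symm, hjk.symm]),
      Finset.sum_insert (by simpa using hji.symm), Finset.sum_singleton, ← hv, pointForm_self hk,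
      mul_zero, zero_add]
  have hd1 : eval v (pderiv i f) = eval v (a i) := by
    rw [ha2, map_add, map_add, hd, hd]
    simp [hik.symm, hji]
  refine ⟨pointForm v k j, pointForm_isHomogeneous _ _ _, hf, hP,
    (mem_pointIdeal_iff_eval_rep (pointForm_isHomogeneous _ _ _)).2 (hev j), ?_, ?_⟩
  -- If `ℓ j = f * c`, the `i`-th derivative at `v` gives `c(v) = 0`, and then the `j`-th gives `1 =
  -- 0`.
  · rintro ⟨c, hc⟩
    have hfv : eval v f = 0 := (mem_pointIdeal_iff P f).1 hP v (rep_mem_submodule P)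
    have hdl : ∀ l, eval v (pderiv l (1 * pointForm v k j)) =
        eval v c * eval v (pderiv l f) := by
      intro l
      rw [one_mul, hc, Derivation.leibniz, map_add, smul_eq_mul, smul_eq_mul, map_mul, map_mul,
        hfv, zero_mul, zero_add]
    have h1 := hdl i
    rw [hd, hd1] at h1
    have h2 := hdl j
    rw [hd] at h2
    have hc0 : eval v c = 0 := by simpa [hji, hik.symm, hai] using h1
    rw [hc0] at h2
    simp [hjk.symm] at h2
  · refine ⟨a i, fun h => hai ((mem_pointIdeal_iff P _).1 h v (rep_mem_submodule P)), ?_⟩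
    intro b hb
    rw [pointIdeal_eq_span_pair P hk huniv] at hb
    obtain ⟨x, y, rfl⟩ := Ideal.mem_span_pair.1 hb
    refine Ideal.mem_span_pair.2 ⟨x, a i * y - x * a j, ?_⟩
    rw [← hv]
    linear_combination x * ha2

/-- Two plane curves without a common component meet in finitely many points. -/
lemma finite_common_zeros {f g : CPoly} (hf : Prime f) (hfg : ¬ f ∣ g) :
    {P : CPlane | f ∈ pointIdeal P ∧ g ∈ pointIdeal P}.Finite := by
  -- Each common point gives a minimal prime of `(f, g)`: a smaller prime `q` would yield a chain `0
  -- < (f) < q < pointIdeal P`, against height at most 2.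
  refine Set.Finite.of_finite_image (f := pointIdeal)
    ((Ideal.finite_minimalPrimes_of_isNoetherianRing CPoly (Ideal.span {f, g})).subset ?_)
    pointIdeal_injective.injOn
  rintro _ ⟨P, ⟨hfP, hgP⟩, rfl⟩
  have hle : Ideal.span {f, g} ≤ pointIdeal P := by
    rw [Ideal.span_le]; rintro x (rfl | rfl) <;> assumption
  obtain ⟨q, hq, hqP⟩ := Ideal.exists_minimalPrimes_le hle
  rcases hqP.eq_or_lt with rfl | hlt
  · exact hq
  have := hq.1.1
  have hfq : Ideal.span {f} < q := by
    refine lt_of_le_of_ne ?_ ?_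
    · rw [Ideal.span_singleton_le_iff_mem]; exact hq.1.2 (Ideal.subset_span (by simp))
    · intro h
      have : g ∈ q := hq.1.2 (Ideal.subset_span (by simp))
      rw [← h, Ideal.mem_span_singleton] at this
      exact hfg this
  have := (Ideal.span_singleton_prime hf.ne_zero).2 hf
  have h0 : (⊥ : Ideal CPoly) < Ideal.span {f} :=
    bot_lt_iff_ne_bot.2 (by simpa using hf.ne_zero)
  have : (⊥ : Ideal CPoly).IsPrime := Ideal.isPrime_bot
  have h1 := Ideal.height_add_one_le_of_lt_of_isPrime h0
  have h2 := Ideal.height_add_one_le_of_lt_of_isPrime hfq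
  have h3 := Ideal.height_add_one_le_of_lt_of_isPrime hlt
  have h4 := height_pointIdeal_le P
  have h6 : (3 : ℕ∞) ≤ 2 := calc
    (3 : ℕ∞) = 0 + 1 + 1 + 1 := by norm_num
    _ ≤ (⊥ : Ideal CPoly).height + 1 + 1 + 1 := by gcongr; exact zero_le
    _ ≤ (Ideal.span {f}).height + 1 + 1 := by gcongr
    _ ≤ q.height + 1 := by gcongr
    _ ≤ (pointIdeal P).height := h3
    _ ≤ 2 := h4
  exact absurd h6 (by decide)

end Points

/-! ### Irreducibility of smooth plane curves. -/

section Irreducible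

/-- An ideal whose zeros are all equal to the origin contains all forms of large degree. -/
lemma exists_pow_idealOfVars_le {I : Ideal CPoly}
    (hI : ∀ v : Fin 3 → ℂ, (∀ a ∈ I, eval v a = 0) → v = 0) :
    ∃ n, idealOfVars (Fin 3) ℂ ^ n ≤ I := by
  refine Ideal.exists_pow_le_of_le_radical_of_fg ?_ (idealOfVars_fg _ _)
  rw [← vanishingIdeal_zeroLocus_eq_radical (K := ℂ) I, idealOfVars, Ideal.span_le]
  rintro _ ⟨i, rfl⟩ v hv
  rw [hI v fun a ha => by simpa [aeval_eq_eval] using hv a ha]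
  simp

/-- Two curves in the plane meet. -/
lemma exists_common_zero {g h : CPoly} (hg : eval 0 g = 0) (hh : eval 0 h = 0) :
    ∃ v ≠ 0, eval v g = 0 ∧ eval v h = 0 := by
  by_contra! H
  -- If the origin were the only common zero, `N` would be minimal over `(g, h)`, hence of height at
  -- most 2 by Krull; but `0 < q₁ < q₂ < N`.
  let N : Ideal CPoly := RingHom.ker (eval (0 : Fin 3 → ℂ))
  let q₁ : Ideal CPoly := RingHom.ker (aeval ![0, X 1, X 2] : CPoly →ₐ[ℂ] CPoly)
  let q₂ : Ideal CPoly := RingHom.ker (aeval ![0, 0, X 2] : CPoly →ₐ[ℂ] CPoly)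
  have hN : N.IsPrime := RingHom.ker_isPrime _
  have hq₁ : q₁.IsPrime := RingHom.ker_isPrime _
  have hq₂ : q₂.IsPrime := RingHom.ker_isPrime _
  have h12 : (aeval ![0, 0, X 2] : CPoly →ₐ[ℂ] CPoly).comp
      (aeval ![0, X 1, X 2] : CPoly →ₐ[ℂ] CPoly) = aeval ![0, 0, X 2] := by
    ext i; fin_cases i <;> simp
  have h23 : (aeval (0 : Fin 3 → ℂ) : CPoly →ₐ[ℂ] ℂ).comp
      (aeval ![0, 0, X 2] : CPoly →ₐ[ℂ] CPoly) = aeval (0 : Fin 3 → ℂ) := by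
    ext i; fin_cases i <;> simp
  have hX0 : (X 0 : CPoly) ∈ q₁ := by simp [q₁, RingHom.mem_ker]
  have hX1 : (X 1 : CPoly) ∈ q₂ := by simp [q₂, RingHom.mem_ker]
  have hX1' : (X 1 : CPoly) ∉ q₁ := by simp [q₁, RingHom.mem_ker]
  have hX2 : (X 2 : CPoly) ∈ N := by simp [N, RingHom.mem_ker]
  have hX2' : (X 2 : CPoly) ∉ q₂ := by simp [q₂, RingHom.mem_ker]
  have l1 : (⊥ : Ideal CPoly) < q₁ :=
    bot_lt_iff_ne_bot.2 fun h => by rw [h] at hX0; exact X_ne_zero _ ((Submodule.mem_bot _).1 hX0)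
  have l2 : q₁ < q₂ := by
    refine SetLike.lt_iff_le_and_exists.2 ⟨fun a ha => ?_, _, hX1, hX1'⟩
    have := DFunLike.congr_fun h12 a
    have ha' : (aeval ![0, X 1, X 2] : CPoly →ₐ[ℂ] CPoly) a = 0 := ha
    rw [AlgHom.comp_apply, ha', map_zero] at this
    exact this.symm
  have l3 : q₂ < N := by
    refine SetLike.lt_iff_le_and_exists.2 ⟨fun a ha => ?_, _, hX2, hX2'⟩
    have := DFunLike.congr_fun h23 a
    have ha' : (aeval ![0, 0, X 2] : CPoly →ₐ[ℂ] CPoly) a = 0 := ha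
    rw [AlgHom.comp_apply, ha', map_zero, aeval_eq_eval] at this
    exact this.symm
  have : (⊥ : Ideal CPoly).IsPrime := Ideal.isPrime_bot
  have hNI : N ∈ (Ideal.span {g, h}).minimalPrimes := by
    refine ⟨⟨hN, ?_⟩, fun q hq _ => ?_⟩
    · rw [Ideal.span_le]; rintro x (rfl | rfl) <;> assumption
    · obtain ⟨n, hn⟩ := exists_pow_idealOfVars_le (I := Ideal.span {g, h}) (fun v hv => by
        by_contra hv0
        exact H v hv0 (hv g (Ideal.subset_span (by simp))) (hv h (Ideal.subset_span (by simp))))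
      have := hq.1
      intro a ha
      refine this.le_of_pow_le (hn.trans hq.2) ?_
      rw [← pow_one (idealOfVars (Fin 3) ℂ), mem_pow_idealOfVars_iff']
      intro x hx
      rw [Nat.lt_one_iff, Finsupp.degree_eq_zero_iff] at hx
      rw [hx, ← constantCoeff_eq, ← MvPolynomial.eval_zero]
      exact ha
  have h4 := Ideal.height_le_card_of_mem_minimalPrimes_span (Set.toFinite _) hNI
  have h6 : (3 : ℕ∞) ≤ 2 := calc
    (3 : ℕ∞) = 0 + 1 + 1 + 1 := by norm_num
    _ ≤ (⊥ : Ideal CPoly).height + 1 + 1 + 1 := by gcongr; exact zero_le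
    _ ≤ q₁.height + 1 + 1 := by gcongr; exact Ideal.height_add_one_le_of_lt_of_isPrime l1
    _ ≤ q₂.height + 1 := by gcongr; exact Ideal.height_add_one_le_of_lt_of_isPrime l2
    _ ≤ N.height := Ideal.height_add_one_le_of_lt_of_isPrime l3
    _ ≤ _ := h4
    _ ≤ 2 := by exact_mod_cast (Set.ncard_insert_le _ _).trans (by rw [Set.ncard_singleton])
  exact absurd h6 (by decide)

/-- `g` is invertible modulo the `d`-th power of the irrelevant ideal. That power contains `g * h`,
hence `h`, so `h` already has degree at least `d` and `g` is constant. -/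
lemma isUnit_of_isHomogeneous_mul_of_eval_zero_ne_zero {g h : CPoly} {d : ℕ}
    (hgh : (g * h).IsHomogeneous d) (h0 : g * h ≠ 0) (hg : eval 0 g ≠ 0) : IsUnit g := by
  have hgc : coeff 0 g ≠ 0 := by rwa [MvPolynomial.eval_zero, constantCoeff_eq] at hg
  have hdeg := totalDegree_mul_of_isDomain (left_ne_zero_of_mul h0) (right_ne_zero_of_mul h0)
  rw [hgh.totalDegree h0] at hdeg
  have hN : (idealOfVars (Fin 3) ℂ) ^ d ⊔ Ideal.span {g} = ⊤ := by
    rw [sup_comm]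
    refine Ideal.sup_pow_eq_top ?_
    rw [Ideal.eq_top_iff_one]
    have h1 : g - C (coeff 0 g) ∈ idealOfVars (Fin 3) ℂ := by
      rw [← pow_one (idealOfVars (Fin 3) ℂ), mem_pow_idealOfVars_iff']
      intro x hx
      rw [Nat.lt_one_iff, Finsupp.degree_eq_zero_iff] at hx
      simp [hx]
    have h2 : C (coeff 0 g) ∈ Ideal.span {g} ⊔ idealOfVars (Fin 3) ℂ := by
      have := sub_mem (Ideal.mem_sup_left (Ideal.mem_span_singleton_self g) :
        g ∈ Ideal.span {g} ⊔ idealOfVars (Fin 3) ℂ) (Ideal.mem_sup_right h1)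
      rwa [sub_sub_cancel] at this
    have h3 := Ideal.mul_mem_left _ (C (coeff 0 g)⁻¹) h2
    rwa [← C_mul, inv_mul_cancel₀ hgc, C_1] at h3
  have hhN : h ∈ (idealOfVars (Fin 3) ℂ) ^ d := by
    obtain ⟨a, ha, b, hb, hab⟩ := Submodule.mem_sup.1 ((Ideal.eq_top_iff_one _).1 hN)
    obtain ⟨c, rfl⟩ := Ideal.mem_span_singleton.1 hb
    have : h = a * h + c * (g * h) := by linear_combination -h * hab
    rw [this]
    refine add_mem (Ideal.mul_mem_right _ _ ha) (Ideal.mul_mem_left _ _ ?_)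
    rw [mem_pow_idealOfVars_iff']
    exact fun x hx => hgh.coeff_eq_zero hx.ne
  have hdh : d ≤ h.totalDegree := by
    obtain ⟨x, hx⟩ := ne_zero_iff.1 (right_ne_zero_of_mul h0)
    rw [← mem_support_iff] at hx
    exact ((mem_pow_idealOfVars_iff _ _).1 hhN x hx).trans
      ((Finsupp.degree_eq_sum _).le.trans (by simpa [Finsupp.sum_fintype] using le_totalDegree hx))
  have hg0 : g.totalDegree = 0 := by omega
  rw [totalDegree_eq_zero_iff_eq_C] at hg0
  rw [hg0]
  exact (isUnit_iff_ne_zero.2 hgc).map C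

lemma IsSmoothCurve.ne_zero {f : CPoly} (hs : IsSmoothCurve f) : f ≠ 0 := by
  rintro rfl
  obtain ⟨i, hi⟩ := hs (fun _ => 1) (Function.ne_iff.2 ⟨0, one_ne_zero⟩) (map_zero _)
  exact hi (by simp)

/-- A smooth plane curve is irreducible. -/
lemma IsSmoothCurve.prime {f : CPoly} {d : ℕ} (hs : IsSmoothCurve f) (hf : f.IsHomogeneous d)
    (hd : d ≠ 0) : Prime f := by
  refine Irreducible.prime ⟨fun h => ?_, fun g h hgh => ?_⟩
  · have := hf.totalDegree hs.ne_zero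
    rw [(isUnit_iff_totalDegree_of_isReduced.1 h).2] at this
    exact hd this.symm
  · by_contra! H
    have hf0 := hs.ne_zero
    rw [hgh] at hf hf0
    have hg0 : eval 0 g = 0 := by
      by_contra h; exact H.1 (isUnit_of_isHomogeneous_mul_of_eval_zero_ne_zero hf hf0 h)
    have hh0 : eval 0 h = 0 := by
      by_contra h
      rw [mul_comm] at hf hf0
      exact H.2 (isUnit_of_isHomogeneous_mul_of_eval_zero_ne_zero hf hf0 h)
    -- The product rule makes a common zero of the two factors a singular point.
    obtain ⟨v, hv, hgv, hhv⟩ := exists_common_zero hg0 hh0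
    obtain ⟨i, hi⟩ := hs v hv (by rw [hgh, map_mul, hgv, zero_mul])
    refine hi ?_
    rw [hgh, Derivation.leibniz]
    simp [hgv, hhv]

end Irreducible

/-! ### The Hilbert function of `(f, g)`. -/

section HilbertFunction

/-- The space of ternary forms of degree `n`. -/
abbrev forms (n : ℕ) : Submodule ℂ CPoly := homogeneousSubmodule (Fin 3) ℂ n

instance finiteDimensional_forms (n : ℕ) : FiniteDimensional ℂ (forms n) :=
  Module.Finite.iff_fg.2 (homogeneousSubmodule_fg _ _ n)

lemma finrank_forms (n : ℕ) : Module.finrank ℂ (forms n) = (n + 2).choose 2 := by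
  have e : {x : Fin 3 →₀ ℕ | x.degree = n} = ((Finset.univ : Finset (Fin 3)).finsuppAntidiag n :
      Set (Fin 3 →₀ ℕ)) := by
    ext x; simp [Finset.mem_finsuppAntidiag, Finsupp.degree_eq_sum]
  rw [forms, homogeneousSubmodule_eq_finsupp_supported,
    (AddMonoidAlgebra.supportedEquivFinsupp _).finrank_eq, e]
  simp only [Module.finrank_finsupp_self, SetLike.coe_sort_coe, Fintype.card_coe,
    Finset.card_finsuppAntidiag_nat_eq_choose]
  rw [Finset.card_univ, Fintype.card_fin, show 3 + n - 1 = n + 2 by omega]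
  exact Nat.choose_symm_add

lemma two_mul_finrank_forms (n : ℕ) :
    2 * Module.finrank ℂ (forms n) = (n + 1) * (n + 2) := by
  rw [finrank_forms, Nat.choose_two_right, Nat.mul_div_cancel' (Nat.even_mul_pred_self _).two_dvd]
  simp [mul_comm]

lemma homogeneousComponent_add_mul {g : CPoly} {e : ℕ} (hg : g.IsHomogeneous e) (m : ℕ)
    (a : CPoly) :
    homogeneousComponent (m + e) (a * g) = homogeneousComponent m a * g := by
  conv_lhs => rw [← sum_homogeneousComponent a]
  rw [Finset.sum_mul, map_sum]
  have : ∀ i, homogeneousComponent (m + e) (homogeneousComponent i a * g) =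
      if m = i then homogeneousComponent i a * g else 0 := by
    intro i
    rw [homogeneousComponent_of_mem ((homogeneousComponent_isHomogeneous i a).mul hg)]
    simp
  simp only [this, Finset.sum_ite_eq, Finset.mem_range]
  split_ifs with h
  · rfl
  · rw [homogeneousComponent_eq_zero _ _ (by omega), zero_mul]

lemma homogeneousComponent_mem_span {s : Set CPoly} (hs : ∀ x ∈ s, ∃ n, x.IsHomogeneous n)
    {p : CPoly} (hp : p ∈ Ideal.span s) (m : ℕ) : homogeneousComponent m p ∈ Ideal.span s :=
  letI := MvPolynomial.gradedAlgebra (σ := Fin 3) (R := ℂ)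
  homogeneousComponent_mem_of_mem (Ideal.homogeneous_span _ _ hs) hp m

/-- The space of multiples `g a` of `g` with `a` a form of degree `n`. -/
noncomputable def mulForms (g : CPoly) (n : ℕ) : Submodule ℂ CPoly :=
  (forms n).map (LinearMap.mulLeft ℂ g)

instance finiteDimensional_mulForms (g : CPoly) (n : ℕ) : FiniteDimensional ℂ (mulForms g n) :=
  inferInstanceAs (FiniteDimensional ℂ ((forms n).map (LinearMap.mulLeft ℂ g)))

lemma finrank_mulForms {g : CPoly} (hg : g ≠ 0) (n : ℕ) :
    Module.finrank ℂ (mulForms g n) = Module.finrank ℂ (forms n) :=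
  (Submodule.equivMapOfInjective _ (mul_right_injective₀ hg) _).finrank_eq.symm

/-- The forms of degree `n` in an ideal. -/
noncomputable def idealForms (I : Ideal CPoly) (n : ℕ) : Submodule ℂ CPoly :=
  I.restrictScalars ℂ ⊓ forms n

instance finiteDimensional_idealForms (I : Ideal CPoly) (n : ℕ) :
    FiniteDimensional ℂ (idealForms I n) :=
  Submodule.finiteDimensional_of_le (inf_le_right : idealForms I n ≤ forms n)

variable {f g : CPoly} {d e : ℕ}

lemma idealForms_span_pair (hf : f.IsHomogeneous d) (hg : g.IsHomogeneous e) (k : ℕ) :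
    idealForms (Ideal.span {f, g}) (d + e + k) = mulForms f (e + k) ⊔ mulForms g (d + k) := by
  apply le_antisymm
  · rintro h ⟨hI, hh⟩
    obtain ⟨a, b, rfl⟩ := Ideal.mem_span_pair.1 hI
    rw [← homogeneousComponent_eq_self hh, map_add]
    refine Submodule.add_mem_sup ?_ ?_
    · rw [show d + e + k = e + k + d by ring, homogeneousComponent_add_mul hf]
      exact ⟨_, homogeneousComponent_isHomogeneous _ _, mul_comm _ _⟩
    · rw [show d + e + k = d + k + e by ring, homogeneousComponent_add_mul hg]
      exact ⟨_, homogeneousComponent_isHomogeneous _ _, mul_comm _ _⟩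
  · refine sup_le ?_ ?_
    · rintro _ ⟨a, ha, rfl⟩
      exact ⟨Ideal.mul_mem_right _ _ (Ideal.subset_span (by simp)),
        (add_assoc d e k).symm ▸ hf.mul ha⟩
    · rintro _ ⟨a, ha, rfl⟩
      exact ⟨Ideal.mul_mem_right _ _ (Ideal.subset_span (by simp)),
        (show e + (d + k) = d + e + k by ring) ▸ hg.mul ha⟩

lemma mulForms_inf_mulForms (hfp : Prime f) (hfg : ¬ f ∣ g) (hf : f.IsHomogeneous d)
    (hg : g.IsHomogeneous e) (k : ℕ) :
    mulForms f (e + k) ⊓ mulForms g (d + k) = mulForms (f * g) k := by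
  apply le_antisymm
  · rintro _ ⟨⟨a, ha, rfl⟩, ⟨b, hb, hab⟩⟩
    have hab : g * b = f * a := hab
    obtain ⟨c, rfl⟩ := (hfp.dvd_or_dvd (Dvd.intro a hab.symm)).resolve_left hfg
    refine ⟨homogeneousComponent k c, homogeneousComponent_isHomogeneous _ _, ?_⟩
    have hb' : (f * c).IsHomogeneous (d + k) := hb
    have h1 := homogeneousComponent_add_mul hf k c
    rw [mul_comm c, add_comm k, homogeneousComponent_eq_self hb'] at h1
    change f * g * homogeneousComponent k c = f * a
    rw [← hab, h1]
    ring
  · rintro _ ⟨a, ha, rfl⟩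
    exact ⟨⟨g * a, hg.mul ha, (mul_assoc _ _ _).symm⟩,
      ⟨f * a, hf.mul ha, show g * (f * a) = f * g * a by ring⟩⟩

/-- Inclusion–exclusion for the multiples of `f` and of `g`, whose intersection is the multiples of
`f * g`; the binomial counts leave `d * e`. -/
lemma finrank_idealForms_span_pair (hfp : Prime f) (hfg : ¬ f ∣ g) (hf : f.IsHomogeneous d)
    (hg : g.IsHomogeneous e) {n : ℕ} (hn : d + e ≤ n) :
    Module.finrank ℂ (idealForms (Ideal.span {f, g}) n) + d * e = Module.finrank ℂ (forms n) := by
  obtain ⟨k, rfl⟩ := Nat.exists_eq_add_of_le hn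
  have hg0 : g ≠ 0 := fun h => hfg (h ▸ dvd_zero f)
  have h := Submodule.finrank_sup_add_finrank_inf_eq (mulForms f (e + k)) (mulForms g (d + k))
  rw [← idealForms_span_pair hf hg, mulForms_inf_mulForms hfp hfg hf hg,
    finrank_mulForms hfp.ne_zero, finrank_mulForms hg0,
    finrank_mulForms (mul_ne_zero hfp.ne_zero hg0)] at h
  have h1 := two_mul_finrank_forms k
  have h2 := two_mul_finrank_forms (e + k)
  have h3 := two_mul_finrank_forms (d + k)
  have h4 := two_mul_finrank_forms (d + e + k)
  nlinarith

/-- A linear form without zeros in common with `f` and `g` is a nonzerodivisor modulo `(f, g)` in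
large degrees. -/
lemma exists_forall_mem_of_mul_mem (hfp : Prime f) (hfg : ¬ f ∣ g) (hf : f.IsHomogeneous d)
    (hg : g.IsHomogeneous e) {l : CPoly} (hl : l.IsHomogeneous 1) (hl0 : l ≠ 0)
    (hz : ∀ v, eval v f = 0 → eval v g = 0 → eval v l = 0 → v = 0) :
    ∃ N, ∀ n ≥ N, ∀ h : CPoly, h.IsHomogeneous n → l * h ∈ Ideal.span {f, g} →
      h ∈ Ideal.span {f, g} := by
  set I := Ideal.span {f, g} with hI
  obtain ⟨N, hN⟩ := exists_pow_idealOfVars_le (I := Ideal.span {l} ⊔ I) (fun v hv => by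
    refine hz v (hv _ ?_) (hv _ ?_) (hv _ ?_)
    · exact Ideal.mem_sup_right (Ideal.subset_span (by simp))
    · exact Ideal.mem_sup_right (Ideal.subset_span (by simp))
    · exact Ideal.mem_sup_left (Ideal.subset_span (by simp)))
  refine ⟨N + (d + e), fun n hn h hh hlh => ?_⟩
  -- By the Nullstellensatz, multiplication by `l` is surjective on the quotient by `I` from degree
  -- `n` to `n + 1`. Both graded pieces have dimension `d * e`, so it is also injective.
  have hsup : mulForms l n ⊔ idealForms I (n + 1) = forms (n + 1) := by
    refine le_antisymm (sup_le ?_ inf_le_right) fun a ha => ?_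
    · rintro _ ⟨a, ha, rfl⟩
      exact add_comm 1 n ▸ hl.mul ha
    · have haN : a ∈ Ideal.span {l} ⊔ I := hN ((mem_pow_idealOfVars_iff' _ _).2 fun x hx =>
        ha.coeff_eq_zero (by omega))
      obtain ⟨b, hb, c, hc, rfl⟩ := Submodule.mem_sup.1 haN
      obtain ⟨b, rfl⟩ := Ideal.mem_span_singleton.1 hb
      obtain ⟨x, y, rfl⟩ := Ideal.mem_span_pair.1 hc
      obtain ⟨k, hk⟩ : ∃ k, n + 1 = k + d + e := ⟨n + 1 - d - e, by omega⟩
      rw [← homogeneousComponent_eq_self ha, map_add, mul_comm l, homogeneousComponent_add_mul hl]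
      refine Submodule.add_mem_sup ⟨_, homogeneousComponent_isHomogeneous _ _, mul_comm _ _⟩
        ⟨?_, homogeneousComponent_isHomogeneous _ _⟩
      rw [map_add, hk, homogeneousComponent_add_mul hg, add_right_comm,
        homogeneousComponent_add_mul hf]
      exact Ideal.mem_span_pair.2 ⟨_, _, rfl⟩
  have h1 := Submodule.finrank_sup_add_finrank_inf_eq (mulForms l n) (idealForms I (n + 1))
  have h2 := finrank_idealForms_span_pair hfp hfg hf hg (n := n) (by omega)
  have h3 := finrank_idealForms_span_pair hfp hfg hf hg (n := n + 1) (by omega)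
  rw [hsup, finrank_mulForms hl0] at h1
  rw [← hI] at h2 h3
  have hle : (idealForms I n).map (LinearMap.mulLeft ℂ l) ≤
      mulForms l n ⊓ idealForms I (n + 1) := by
    rintro _ ⟨a, ⟨haI, ha⟩, rfl⟩
    exact ⟨⟨a, ha, rfl⟩, Ideal.mul_mem_left _ _ haI, add_comm 1 n ▸ hl.mul ha⟩
  have heq := Submodule.eq_of_le_of_finrank_eq hle (by
    rw [← (Submodule.equivMapOfInjective _ (mul_right_injective₀ hl0 :
      Function.Injective (LinearMap.mulLeft ℂ l)) (idealForms I n)).finrank_eq]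
    omega)
  have hmem : l * h ∈ mulForms l n ⊓ idealForms I (n + 1) :=
    ⟨⟨h, hh, rfl⟩, hlh, add_comm 1 n ▸ hl.mul hh⟩
  rw [← heq] at hmem
  obtain ⟨a, ha, hah⟩ := hmem
  exact mul_right_injective₀ hl0 hah ▸ ha.1

end HilbertFunction

/-! ### Max Noether's theorem and Bézout's theorem. -/

section Bezout

lemma exists_linear_form_ne_zero (Z : Set CPlane) (hZ : Z.Finite) :
    ∃ l : CPoly, l.IsHomogeneous 1 ∧ l ≠ 0 ∧ ∀ P ∈ Z, l ∉ pointIdeal P := by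
  have := hZ.to_subtype
  -- The extra index `none` keeps the form nonzero even when `Z` is empty.
  let F : Option Z → Module.Dual ℂ (Fin 3 → ℂ) := fun P =>
    P.elim (LinearMap.proj 0) fun P => ∑ i, P.1.rep i • LinearMap.proj i
  obtain ⟨w, hw⟩ := Module.Dual.exists_forall_ne_zero_of_forall_exists F (by
    rintro (_ | P)
    · exact ⟨fun _ => 1, by simp [F]⟩
    · obtain ⟨k, hk⟩ := Function.ne_iff.1 P.1.rep_nonzero
      exact ⟨Pi.single k 1, by simpa [F, Pi.single_apply] using hk⟩)
  have hl : (∑ i, C (w i) * X i : CPoly).IsHomogeneous 1 :=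
    IsHomogeneous.sum _ _ _ fun i _ => isHomogeneous_C_mul_X _ _
  refine ⟨_, hl, fun h => ?_, fun P hP => ?_⟩
  · have h1 := congrArg (eval (Pi.single 0 1)) h
    have h2 := hw none
    simp [Pi.single_apply] at h1
    simp [F, h1] at h2
  · have h2 := hw (some ⟨P, hP⟩)
    rw [mem_pointIdeal_iff_eval_rep hl]
    simpa [F, mul_comm] using h2

variable {f g : CPoly} {d e : ℕ}

/-- Max Noether's theorem in large degrees. -/
lemma exists_forall_mem_of_orderAt_le (hfp : Prime f) (hs : IsSmoothCurve f) (hfg : ¬ f ∣ g)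
    (hf : f.IsHomogeneous d) (hg : g.IsHomogeneous e) :
    ∃ N, ∀ n ≥ N, ∀ h : CPoly, h.IsHomogeneous n →
      (∀ P, f ∈ pointIdeal P → orderAt (pointIdeal P) f g ≤ orderAt (pointIdeal P) f h) →
      h ∈ Ideal.span {f, g} := by
  obtain ⟨l, hl, hl0, hlZ⟩ := exists_linear_form_ne_zero _ (finite_common_zeros hfp hfg)
  obtain ⟨N, hN⟩ := exists_forall_mem_of_mul_mem hfp hfg hf hg hl hl0 (by
    intro v hfv hgv hlv
    by_contra hv
    have hvP : v ∈ (Projectivization.mk ℂ v hv).submodule := by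
      rw [Projectivization.submodule_mk]; exact Submodule.mem_span_singleton_self v
    exact hlZ (Projectivization.mk ℂ v hv)
      ⟨(mem_pointIdeal_iff_of_isHomogeneous hf hv hvP).2 hfv,
        (mem_pointIdeal_iff_of_isHomogeneous hg hv hvP).2 hgv⟩
      ((mem_pointIdeal_iff_of_isHomogeneous hl hv hvP).2 hlv))
  set I := Ideal.span {f, g} with hI
  have hfI : f ∈ I := Ideal.subset_span (by simp)
  have hgI : g ∈ I := Ideal.subset_span (by simp)
  refine ⟨N, fun n hn h hh H => ?_⟩
  -- The ideal `(I : h)` has no zero in the plane: at a point `P` of the curve the inequality of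
  -- orders gives `s * h ∈ I` with `s ∉ pointIdeal P`, and a homogeneous component of `s` does not
  -- vanish at `P`.
  have key : ∀ v : Fin 3 → ℂ, (∀ a ∈ I.colon {h}, eval v a = 0) → v = 0 := by
    intro v hv
    by_contra hv0
    have hvP : v ∈ (Projectivization.mk ℂ v hv0).submodule := by
      rw [Projectivization.submodule_mk]; exact Submodule.mem_span_singleton_self v
    set P := Projectivization.mk ℂ v hv0
    have hfP : f ∈ pointIdeal P := (mem_pointIdeal_iff_of_isHomogeneous hf hv0 hvP).2
      (hv f (Submodule.mem_colon_singleton.2 (Ideal.mul_mem_right _ _ hfI)))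
    obtain ⟨t, -, ht⟩ := exists_isUniformizerAt hfp hs hfP
    obtain ⟨s, hsP, r, c, hc⟩ := ht.orderAt_le_iff.1 (H P hfP)
    obtain ⟨m, hm⟩ := exists_homogeneousComponent_notMem hsP
    rw [mem_pointIdeal_iff_of_isHomogeneous (homogeneousComponent_isHomogeneous m s) hv0 hvP] at hm
    refine hm (hv _ (Submodule.mem_colon_singleton.2 ?_))
    rw [smul_eq_mul, ← homogeneousComponent_add_mul hh]
    refine homogeneousComponent_mem_span ?_ ?_ _
    · rintro x (rfl | rfl)
      exacts [⟨d, hf⟩, ⟨e, hg⟩]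
    · rw [sub_eq_iff_eq_add.1 hc]
      exact add_mem (Ideal.mul_mem_right _ _ hfI) (Ideal.mul_mem_left _ _ hgI)
  -- Hence `l ^ k * h ∈ I` for some `k`, and the factors `l` cancel one at a time.
  obtain ⟨k, hk⟩ := exists_pow_idealOfVars_le key
  have hlk : l ^ k * h ∈ I := by
    have := hk ((mem_pow_idealOfVars_iff' k (l ^ k)).2 fun x hx =>
      (hl.pow k).coeff_eq_zero (by omega))
    exact Submodule.mem_colon_singleton.1 this
  clear key hk
  induction k with
  | zero => simpa using hlk
  | succ k ih =>
    refine ih (hN (k + n) (by omega) _ ?_ ?_)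
    · have := (hl.pow k).mul hh; rwa [one_mul] at this
    · rwa [← mul_assoc, ← pow_succ']

lemma orderAt_le_orderAt_C_mul {P : CPlane} {t : CPoly} (ht : IsUniformizerAt (pointIdeal P) f t) (c : ℂ)
    (h : CPoly) : orderAt (pointIdeal P) f h ≤ orderAt (pointIdeal P) f (C c * h) := by
  rw [ht.orderAt_mul]; exact le_add_self

open Classical in
/-- The forms of degree `n` which vanish on the effective divisor `D` of the curve `f = 0`. -/
noncomputable def divisorForms (hfp : Prime f) (hs : IsSmoothCurve f) (D : Multiset CPlane)
    (n : ℕ) : Submodule ℂ CPoly where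
  carrier := {h | h.IsHomogeneous n ∧
    ∀ P, f ∈ pointIdeal P → (D.count P : ℕ∞) ≤ orderAt (pointIdeal P) f h}
  zero_mem' := ⟨isHomogeneous_zero _ _ n, fun P hP => by
    obtain ⟨t, -, ht⟩ := exists_isUniformizerAt hfp hs hP
    rw [ht.orderAt_eq_top_iff.2 (dvd_zero f)]; exact le_top⟩
  add_mem' := fun {a b} ha hb => ⟨ha.1.add hb.1, fun P hP => by
    obtain ⟨t, -, ht⟩ := exists_isUniformizerAt hfp hs hP
    exact ht.le_orderAt_add (ha.2 P hP) (hb.2 P hP)⟩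
  smul_mem' := fun c a ha => by
    rw [smul_eq_C_mul]
    refine ⟨ha.1.C_mul c, fun P hP => ?_⟩
    obtain ⟨t, -, ht⟩ := exists_isUniformizerAt hfp hs hP
    exact (ha.2 P hP).trans (orderAt_le_orderAt_C_mul ht c a)

instance finiteDimensional_divisorForms (hfp : Prime f) (hs : IsSmoothCurve f)
    (D : Multiset CPlane) (n : ℕ) : FiniteDimensional ℂ (divisorForms hfp hs D n) :=
  Submodule.finiteDimensional_of_le
    (show divisorForms hfp hs D n ≤ forms n from fun _ h => h.1)

open Classical in
/-- A form which vanishes on `D` to the exact order at a given point. -/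
lemma exists_mem_divisorForms_orderAt_eq (hfp : Prime f) (hs : IsSmoothCurve f) {P : CPlane}
    (hP : f ∈ pointIdeal P) (D : Multiset CPlane) {n : ℕ} (hn : D.card ≤ n) :
    ∃ h ∈ divisorForms hfp hs D n, orderAt (pointIdeal P) f h = D.count P := by
  obtain ⟨t, ht1, ht⟩ := exists_isUniformizerAt hfp hs hP
  induction D using Multiset.induction_on generalizing n with
  | empty =>
    obtain ⟨l, hl, -, hlP⟩ := exists_linear_form_ne_zero {P} (Set.finite_singleton P)
    refine ⟨l ^ n, ⟨by simpa using hl.pow n, by simp⟩, ?_⟩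
    rw [Multiset.count_zero, Nat.cast_zero, ht.orderAt_eq_zero_iff]
    exact fun h => hlP P rfl ((pointIdeal_isPrime P).mem_of_pow_mem n h)
  | cons Q D ih =>
    rw [Multiset.card_cons] at hn
    obtain ⟨m, rfl⟩ : ∃ m, n = m + 1 := ⟨n - 1, by omega⟩
    obtain ⟨h, ⟨hh, hD⟩, hhP⟩ := ih (n := m) (by omega)
    -- A linear form through `Q`: the uniformizer if `Q = P`, otherwise one not vanishing at `P`.
    obtain ⟨u, hu, huQ, huP⟩ : ∃ u : CPoly, u.IsHomogeneous 1 ∧ u ∈ pointIdeal Q ∧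
        orderAt (pointIdeal P) f u = if P = Q then 1 else 0 := by
      by_cases hPQ : P = Q
      · subst hPQ
        exact ⟨t, ht1, ht.mem_point, by rw [ht.orderAt_self, if_pos rfl]⟩
      · obtain ⟨k, hk⟩ := Function.ne_iff.1 Q.rep_nonzero
        have hPQ' : ¬ pointIdeal Q ≤ pointIdeal P := by
          intro hle
          have hmem : P.rep ∈ Q.submodule := mem_submodule_of_forall_mem_pointIdeal fun a ha =>
            (mem_pointIdeal_iff P a).1 (hle ha) _ (rep_mem_submodule P)
          refine hPQ (pointIdeal_injective (le_antisymm (fun a ha => ?_) hle))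
          rw [Q.submodule_eq] at hmem
          obtain ⟨c, hc⟩ := Submodule.mem_span_singleton.1 hmem
          have hc0 : c ≠ 0 := fun h => P.rep_nonzero (by rw [← hc, h, zero_smul])
          rw [mem_pointIdeal_iff] at ha ⊢
          intro w hw
          apply ha
          rw [Q.submodule_eq] at hw
          rw [P.submodule_eq]
          obtain ⟨b, rfl⟩ := Submodule.mem_span_singleton.1 hw
          rw [← hc]
          exact Submodule.mem_span_singleton.2 ⟨b * c⁻¹, by
            rw [smul_smul, mul_assoc, inv_mul_cancel₀ hc0, mul_one]⟩
        rw [pointIdeal_eq_span Q hk, Ideal.span_le, Set.not_subset] at hPQ'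
        obtain ⟨_, ⟨i, rfl⟩, hi⟩ := hPQ'
        refine ⟨_, pointForm_isHomogeneous Q.rep k i, ?_, ?_⟩
        · rw [pointIdeal_eq_span Q hk]; exact Ideal.subset_span ⟨i, rfl⟩
        · rw [if_neg hPQ]; exact ht.orderAt_eq_zero_iff.2 hi
    refine ⟨h * u, ⟨hh.mul hu, fun R hR => ?_⟩, ?_⟩
    · obtain ⟨t', -, ht'⟩ := exists_isUniformizerAt hfp hs hR
      rw [ht'.orderAt_mul, Multiset.count_cons, Nat.cast_add]
      refine add_le_add (hD R hR) ?_
      split_ifs with hRQ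
      · rw [Nat.cast_one, Order.one_le_iff_pos, pos_iff_ne_zero, Ne, ht'.orderAt_eq_zero_iff,
          not_not, hRQ]
        exact huQ
      · simp
    · rw [ht.orderAt_mul, hhP, huP, Multiset.count_cons]
      push_cast
      rfl

open Classical in
-- The quotient `h / h₁` is regular at `P` and equals `r' / s'` on the curve, with forms of equal
-- degree. So it has a value `c ∈ ℂ` at `P`, and subtracting `c • h₁` gains one order there.
lemma exists_sub_mem_divisorForms (hfp : Prime f) (hs : IsSmoothCurve f) (hf : f.IsHomogeneous d)
    {P : CPlane} (hP : f ∈ pointIdeal P) {D : Multiset CPlane} {n : ℕ} {h₁ h : CPoly}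
    (h₁D : h₁ ∈ divisorForms hfp hs D n) (h₁P : orderAt (pointIdeal P) f h₁ = D.count P)
    (hD : h ∈ divisorForms hfp hs D n) :
    ∃ c : ℂ, h - c • h₁ ∈ divisorForms hfp hs (P ::ₘ D) n := by
  obtain ⟨t, -, ht⟩ := exists_isUniformizerAt hfp hs hP
  obtain ⟨s, hsP, r, a, ha⟩ := ht.orderAt_le_iff.1 (h₁P ▸ hD.2 P hP)
  obtain ⟨m, hm⟩ := exists_homogeneousComponent_notMem hsP
  have hm' := hm
  rw [mem_pointIdeal_iff_eval_rep (homogeneousComponent_isHomogeneous m s)] at hm'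
  set s' := homogeneousComponent m s
  set r' := homogeneousComponent m r
  have hr' : r'.IsHomogeneous m := homogeneousComponent_isHomogeneous m r
  have hs' : s'.IsHomogeneous m := homogeneousComponent_isHomogeneous m s
  have hdvd : f ∣ s' * h - r' * h₁ := by
    rw [← homogeneousComponent_add_mul hD.1, ← homogeneousComponent_add_mul h₁D.1, ← map_sub,
      ← Ideal.mem_span_singleton]
    refine homogeneousComponent_mem_span ?_
      (Ideal.mem_span_singleton.2 ⟨a, ha⟩) _
    rintro x rfl
    exact ⟨d, hf⟩
  set c := eval P.rep r' / eval P.rep s'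
  have hsub := Submodule.sub_mem _ hD (Submodule.smul_mem _ c h₁D)
  refine ⟨c, hsub.1, fun Q hQ => ?_⟩
  by_cases hQP : Q = P
  · subst hQP
    have hcP : r' - C c * s' ∈ pointIdeal Q := by
      rw [mem_pointIdeal_iff_eval_rep (hr'.sub (hs'.C_mul c))]
      simp [c, hm']
    have h1 : orderAt (pointIdeal Q) f (s' * (h - c • h₁)) =
        orderAt (pointIdeal Q) f (h - c • h₁) := by
      rw [ht.orderAt_mul, ht.orderAt_eq_zero_iff.2 hm, zero_add]
    have h2 : s' * (h - c • h₁) = (s' * h - r' * h₁) + (r' - C c * s') * h₁ := by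
      rw [smul_eq_C_mul]; ring
    rw [← h1, h2]
    refine ht.le_orderAt_add ?_ ?_
    · rw [ht.orderAt_eq_top_iff.2 hdvd]; exact le_top
    · rw [ht.orderAt_mul, h₁P, Multiset.count_cons_self, Nat.cast_succ, add_comm]
      gcongr
      rw [Order.one_le_iff_pos, pos_iff_ne_zero, Ne, ht.orderAt_eq_zero_iff, not_not]
      exact hcP
  · rw [Multiset.count_cons_of_ne hQP]
    exact hsub.2 Q hQ

/-- An effective divisor of degree `m` imposes `m` independent conditions on forms of large
degree. -/
lemma finrank_divisorForms (hfp : Prime f) (hs : IsSmoothCurve f) (hf : f.IsHomogeneous d)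
    (D : Multiset CPlane) (hD : ∀ P ∈ D, f ∈ pointIdeal P) {n : ℕ} (hn : D.card ≤ n) :
    Module.finrank ℂ (divisorForms hfp hs D n) + D.card = Module.finrank ℂ (forms n) := by
  classical
  induction D using Multiset.induction_on with
  | empty =>
    have : divisorForms hfp hs 0 n = forms n :=
      le_antisymm (fun _ h => h.1) fun h hh => ⟨hh, by simp⟩
    rw [this, Multiset.card_zero, add_zero]
  | cons P D ih =>
    rw [Multiset.card_cons] at hn ⊢
    have ih := ih (fun Q hQ => hD Q (Multiset.mem_cons_of_mem hQ)) (by omega)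
    have hP := hD P (Multiset.mem_cons_self P D)
    obtain ⟨h₁, h₁D, h₁P⟩ := exists_mem_divisorForms_orderAt_eq hfp hs hP D (n := n) (by omega)
    have hle : divisorForms hfp hs (P ::ₘ D) n ≤ divisorForms hfp hs D n := fun h hh =>
      ⟨hh.1, fun Q hQ => le_trans (by
        exact_mod_cast Multiset.count_le_of_le Q (Multiset.le_cons_self D P)) (hh.2 Q hQ)⟩
    have h₁n : h₁ ∉ divisorForms hfp hs (P ::ₘ D) n := by
      intro h
      have := h.2 P hP
      rw [h₁P, Multiset.count_cons_self] at this
      exact absurd (Nat.cast_le.1 this) (by omega)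
    have h₁0 : h₁ ≠ 0 := fun h => h₁n (h ▸ Submodule.zero_mem _)
    -- `h₁` spans a complement, so one more point costs exactly one dimension.
    have hsup : divisorForms hfp hs (P ::ₘ D) n ⊔ ℂ ∙ h₁ = divisorForms hfp hs D n := by
      refine le_antisymm (sup_le hle ?_) fun h hh => ?_
      · rwa [Submodule.span_singleton_le_iff_mem]
      · obtain ⟨c, hc⟩ := exists_sub_mem_divisorForms hfp hs hf hP h₁D h₁P hh
        rw [← sub_add_cancel h (c • h₁)]
        exact Submodule.add_mem_sup hc
          (Submodule.smul_mem _ _ (Submodule.mem_span_singleton_self _))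
    have hinf : divisorForms hfp hs (P ::ₘ D) n ⊓ ℂ ∙ h₁ = ⊥ := by
      rw [← disjoint_iff, Submodule.disjoint_span_singleton' h₁0]
      exact h₁n
    have h := Submodule.finrank_sup_add_finrank_inf_eq (divisorForms hfp hs (P ::ₘ D) n) (ℂ ∙ h₁)
    rw [hsup, hinf, finrank_bot, finrank_span_singleton h₁0] at h
    omega

open Classical in
/-- Bézout's theorem for a smooth curve. -/
theorem card_eq_mul_of_count_eq_orderAt (hfp : Prime f) (hs : IsSmoothCurve f) (hfg : ¬ f ∣ g)
    (hf : f.IsHomogeneous d) (hg : g.IsHomogeneous e) (D : Multiset CPlane)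
    (hD : ∀ P ∈ D, f ∈ pointIdeal P)
    (hDg : ∀ P, f ∈ pointIdeal P → (D.count P : ℕ∞) = orderAt (pointIdeal P) f g) :
    D.card = d * e := by
  obtain ⟨N, hN⟩ := exists_forall_mem_of_orderAt_le hfp hs hfg hf hg
  -- Large enough for Noether's theorem, the Hilbert function and the independence of the conditions
  -- at once.
  set n := N + D.card + (d + e)
  have h1 := finrank_idealForms_span_pair hfp hfg hf hg (n := n) (by omega)
  have h2 := finrank_divisorForms hfp hs hf D hD (n := n) (by omega)
  have h3 : divisorForms hfp hs D n = idealForms (Ideal.span {f, g}) n := by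
    refine le_antisymm (fun h hh => ⟨hN n (by omega) h hh.1 fun P hP => hDg P hP ▸ hh.2 P hP,
      hh.1⟩) fun h hh => ⟨hh.2, fun P hP => ?_⟩
    obtain ⟨t, -, ht⟩ := exists_isUniformizerAt hfp hs hP
    obtain ⟨a, b, rfl⟩ := Ideal.mem_span_pair.1 hh.1
    refine ht.le_orderAt_add ?_ ?_
    · rw [ht.orderAt_eq_top_iff.2 (dvd_mul_left f a)]; exact le_top
    · rw [hDg P hP, ht.orderAt_mul]; exact le_add_self
  rw [h3] at h2
  omega

end Bezout

/-! ### Rank one and nonvanishing of the adjugate. -/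

section Adjugate

/-- The adjugate of a singular matrix over a domain has rank at most one. -/
lemma adjugate_mul_adjugate_of_det_eq_zero {n R : Type*} [Fintype n] [DecidableEq n] [CommRing R]
    [IsDomain R] (A : Matrix n n R) (hA : A.det = 0) (i j k l : n) :
    A.adjugate i j * A.adjugate k l = A.adjugate i l * A.adjugate k j := by
  -- A combination of columns `j` and `l` of the adjugate, so killed by `A`, chosen with `i`-th
  -- entry zero.
  let w : n → R := fun m => A.adjugate i j * A.adjugate m l - A.adjugate i l * A.adjugate m j
  have hAw : A.mulVec w = 0 := by
    have h : ∀ c, A.mulVec (fun m => A.adjugate m c) = 0 := fun c => by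
      have := A.mul_adjugate
      rw [hA, zero_smul] at this
      exact funext fun r => congrFun (congrFun this r) c
    have : w = A.adjugate i j • (fun m => A.adjugate m l) -
        A.adjugate i l • (fun m => A.adjugate m j) := rfl
    rw [this, Matrix.mulVec_sub, Matrix.mulVec_smul, Matrix.mulVec_smul, h, h, smul_zero,
      smul_zero, sub_zero]
  have hwi : w i = 0 := by simp only [w]; ring
  -- Replacing row `r` of `A` by the `i`-th unit vector still kills `w`, so the new determinant,
  -- which is `A.adjugate i r`, annihilates `w`.
  have key : ∀ r, A.adjugate i r * w k = 0 := by
    intro r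
    have hB : (A.updateRow r (Pi.single i 1)).mulVec w = 0 := by
      funext m
      by_cases hm : m = r
      · subst hm; simp [Matrix.mulVec, hwi]
      · have := congrFun hAw m
        simpa [Matrix.mulVec, hm] using this
    have h2 : ((A.updateRow r (Pi.single i 1)).adjugate *
        A.updateRow r (Pi.single i 1)).mulVec w = 0 := by
      rw [← Matrix.mulVec_mulVec, hB, Matrix.mulVec_zero]
    rw [Matrix.adjugate_mul, Matrix.smul_mulVec, Matrix.one_mulVec] at h2
    rw [Matrix.adjugate_apply]
    exact congrFun h2 k
  by_cases hj : A.adjugate i j = 0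
  · by_cases hl : A.adjugate i l = 0
    · rw [hj, hl, zero_mul, zero_mul]
    · exact sub_eq_zero.1 ((mul_eq_zero.1 (key l)).resolve_left hl)
  · exact sub_eq_zero.1 ((mul_eq_zero.1 (key j)).resolve_left hj)

/-- Over the domain `R ⧸ (det A)` the matrix becomes singular. -/
lemma dvd_adjugate_mul_sub {n R : Type*} [Fintype n] [DecidableEq n] [CommRing R] [IsDomain R]
    {A : Matrix n n R} (hA : Prime A.det) (i j k l : n) :
    A.det ∣ A.adjugate i j * A.adjugate k l - A.adjugate i l * A.adjugate k j := by
  have := (Ideal.span_singleton_prime hA.ne_zero).2 hA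
  let π := Ideal.Quotient.mk (Ideal.span {A.det})
  have h := adjugate_mul_adjugate_of_det_eq_zero (π.mapMatrix A) (by
    rw [← RingHom.map_det]
    exact Ideal.Quotient.eq_zero_iff_mem.2 (Ideal.mem_span_singleton_self _)) i j k l
  rw [← RingHom.map_adjugate] at h
  simp only [RingHom.mapMatrix_apply, Matrix.map_apply, ← map_mul] at h
  rwa [Ideal.Quotient.mk_eq_mk_iff_sub_mem, Ideal.mem_span_singleton] at h

/-- Degrees may vary by row to allow the constant unit row in the determinants that define the
adjugate. -/
lemma det_isHomogeneous {n σ R : Type*} [Fintype n] [DecidableEq n] [CommRing R]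
    {A : Matrix n n (MvPolynomial σ R)} {c : n → ℕ} (hA : ∀ i j, (A i j).IsHomogeneous (c i)) :
    A.det.IsHomogeneous (∑ i, c i) := by
  rw [Matrix.det_apply]
  refine IsHomogeneous.sum _ _ _ fun τ _ => ?_
  have h : (∏ i, A (τ i) i).IsHomogeneous (∑ i, c i) := by
    rw [← Equiv.sum_comp τ c]
    exact IsHomogeneous.prod _ _ _ fun i _ => hA _ _
  rcases Int.units_eq_one_or (Equiv.Perm.sign τ) with hτ | hτ <;> rw [hτ]
  · simpa using h
  · simpa using h.neg

lemma adjugate_isHomogeneous {n σ R : Type*} [Fintype n] [DecidableEq n] [CommRing R]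
    {A : Matrix n n (MvPolynomial σ R)} (hA : ∀ i j, (A i j).IsHomogeneous 1) (i j : n) :
    (A.adjugate i j).IsHomogeneous (Fintype.card n - 1) := by
  have h : (∑ r, if r = j then 0 else 1) = Fintype.card n - 1 := by
    rw [← Finset.card_univ, ← Finset.card_erase_of_mem (Finset.mem_univ j), Finset.card_eq_sum_ones,
      ← Finset.filter_ne', Finset.sum_filter]
    simp only [ne_eq, ite_not]
  rw [Matrix.adjugate_apply, ← h]
  refine det_isHomogeneous fun r s => ?_
  by_cases hr : r = j
  · subst hr
    rw [if_pos rfl, Matrix.updateRow_self, Pi.single_apply]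
    split_ifs
    · exact isHomogeneous_one _ _
    · exact isHomogeneous_zero _ _ _
  · rw [if_neg hr, Matrix.updateRow_ne hr]
    exact hA r s

/-- The adjugate does not vanish at the nonsingular points of a determinantal hypersurface. -/
lemma exists_eval_adjugate_ne_zero {n σ R : Type*} [Fintype n] [DecidableEq n] [CommRing R]
    [IsDomain R] [Nonempty n] (A : Matrix n n (MvPolynomial σ R)) {v : σ → R} {l : σ}
    (hv : eval v A.det = 0) (hl : eval v (pderiv l A.det) ≠ 0) :
    ∃ i j, eval v (A.adjugate i j) ≠ 0 := by
  by_contra! H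
  let B : Matrix n n R := A.map (eval v)
  let B' : Matrix n n R := (A.adjugate).map fun a => eval v (pderiv l a)
  -- Differentiate `A * adj A = det A • 1` at `v`: the terms containing the adjugate itself vanish.
  -- Taking determinants with `det A(v) = 0` then makes the derivative of `det A` zero.
  have hB : B * B' = eval v (pderiv l A.det) • (1 : Matrix n n R) := by
    ext i j
    have h := congrArg (fun a => eval v (pderiv l a)) (congrFun (congrFun A.mul_adjugate i) j)
    simp only [Matrix.mul_apply, Matrix.smul_apply, smul_eq_mul, map_sum, Derivation.leibniz,
      map_add, map_mul, H, zero_mul, add_zero, hv, zero_add, Matrix.one_apply] at h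
    simp only [Matrix.mul_apply, Matrix.smul_apply, smul_eq_mul, B, B', Matrix.map_apply,
      Matrix.one_apply]
    rw [h]
    split_ifs <;> simp
  have hdet : B.det = 0 := by
    rw [← hv, RingHom.map_det]; rfl
  have := congrArg Matrix.det hB
  rw [Matrix.det_mul, hdet, zero_mul, Matrix.det_smul, Matrix.det_one, mul_one] at this
  exact hl ((pow_eq_zero_iff Fintype.card_ne_zero).1 this.symm)

end Adjugate

/-! ### Complex conjugation of polynomials, points and orders. -/

section Conjugation

/-- Conjugation of the coefficients. -/
noncomputable def conjPoly : CPoly ≃+* CPoly := mapEquiv (Fin 3) (starRingAut (R := ℂ))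

lemma conjPoly_apply (a : CPoly) : conjPoly a = MvPolynomial.map (starRingEnd ℂ) a := rfl

lemma conjPoly_toComplex (f : RPoly) : conjPoly f.toComplex = f.toComplex := by
  have : (starRingEnd ℂ).comp (algebraMap ℝ ℂ) = algebraMap ℝ ℂ := RingHom.ext Complex.conj_ofReal
  rw [conjPoly_apply, RPoly.toComplex, MvPolynomial.map_map, this]

lemma exists_toComplex_eq {a : CPoly} (ha : conjPoly a = a) : ∃ g : RPoly, g.toComplex = a := by
  have : a ∈ Set.range (MvPolynomial.map (σ := Fin 3) (algebraMap ℝ ℂ)) := by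
    rw [mem_range_map_iff_coeffs_subset]
    intro c hc
    obtain ⟨x, -, rfl⟩ := mem_coeffs_iff.1 hc
    have h := congrArg (coeff x) ha
    rw [conjPoly_apply, coeff_map, Complex.conj_eq_iff_real] at h
    obtain ⟨r, hr⟩ := h
    exact ⟨r, hr.symm⟩
  exact this

lemma eval_conj_conjPoly (a : CPoly) (v : Fin 3 → ℂ) :
    eval (fun i => conj (v i)) (conjPoly a) = conj (eval v a) := by
  rw [conjPoly_apply, eval_map, ← coe_eval₂Hom]
  exact (DFunLike.congr_fun (comp_eval₂Hom (RingHom.id ℂ) v (starRingEnd ℂ)) a).symm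

lemma conjPoint_conjPoint (P : CPlane) : conjPoint (conjPoint P) = P := by
  induction P using Projectivization.ind with
  | h v hv => rw [conjPoint_mk, conjPoint_mk]; simp

lemma conj_mem_conjPoint {P : CPlane} {w : Fin 3 → ℂ} (hw : w ∈ P.submodule) :
    (fun i => conj (w i)) ∈ (conjPoint P).submodule := by
  induction P using Projectivization.ind with
  | h v hv =>
    rw [Projectivization.submodule_mk] at hw
    rw [conjPoint_mk, Projectivization.submodule_mk]
    obtain ⟨t, rfl⟩ := Submodule.mem_span_singleton.1 hw
    exact Submodule.mem_span_singleton.2 ⟨conj t, by funext i; simp⟩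

lemma conjPoly_mem_pointIdeal_iff (P : CPlane) (a : CPoly) :
    conjPoly a ∈ pointIdeal (conjPoint P) ↔ a ∈ pointIdeal P := by
  rw [mem_pointIdeal_iff, mem_pointIdeal_iff]
  constructor
  · intro h w hw
    have := h _ (conj_mem_conjPoint hw)
    rwa [eval_conj_conjPoly, map_eq_zero] at this
  · intro h w hw
    have := h _ (conjPoint_conjPoint P ▸ conj_mem_conjPoint hw)
    rw [← map_eq_zero (starRingEnd ℂ), ← eval_conj_conjPoly] at this
    simpa using this

lemma orderAt_conjPoint {f : RPoly} {P : CPlane} {t : CPoly}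
    (ht : IsUniformizerAt (pointIdeal P) f.toComplex t) (g : CPoly) :
    orderAt (pointIdeal (conjPoint P)) f.toComplex (conjPoly g) =
      orderAt (pointIdeal P) f.toComplex g := by
  have := ht.orderAt_map_ringEquiv conjPoly (conjPoly_mem_pointIdeal_iff P) g
  rwa [conjPoly_toComplex] at this

end Conjugation

/-! ### Degrees and conjugates of divisors. -/

section Divisors

lemma CurveDiv.degree_add {f : CPoly} (D E : CurveDiv f) :
    (D + E).degree = D.degree + E.degree :=
  Finsupp.sum_add_index' (fun _ => rfl) fun _ _ _ => rfl

lemma CurveDiv.degree_conjugate {f : RPoly} (D : CurveDiv f.toComplex) :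
    D.conjugate.degree = D.degree :=
  Finsupp.sum_mapDomain_index (fun _ => rfl) fun _ _ _ => rfl

lemma CurveDiv.conjugate_apply {f : RPoly} (D : CurveDiv f.toComplex)
    (P : projectiveZeros f.toComplex) : D.conjugate P = D ⟨conjPoint P.1, conjPoint_mem f P.2⟩ := by
  let φ : projectiveZeros f.toComplex → projectiveZeros f.toComplex :=
    fun P => ⟨conjPoint P.1, conjPoint_mem f P.2⟩
  have hφ : Function.Involutive φ := fun P => Subtype.ext (conjPoint_conjPoint P.1)
  change Finsupp.mapDomain φ D P = D (φ P)
  conv_lhs => rw [← hφ P]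
  exact Finsupp.mapDomain_apply hφ.injective _ _

/-- Bézout's theorem for the intersection divisors on a smooth curve. -/
theorem IsIntersectionDivisor.degree_eq {f g : CPoly} {d e : ℕ} {E : CurveDiv f}
    (h : IsIntersectionDivisor f g E) (hfp : Prime f) (hs : IsSmoothCurve f)
    (hf : f.IsHomogeneous d) (hg : g.IsHomogeneous e) : E.degree = (d * e : ℕ) := by
  classical
  -- Intersection divisors have nonnegative coefficients, so `Int.toNat` loses nothing.
  let D : CurveDiv f → Multiset CPlane := fun E =>
    (Finsupp.toMultiset (E.mapRange Int.toNat rfl)).map Subtype.val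
  have hcount : ∀ P : projectiveZeros f, ((D E).count P.1 : ℕ∞) =
      intersectionMultiplicity P.1 f g ∧ E P = (D E).count P.1 := by
    intro P
    obtain ⟨n, hn, hE⟩ := h.2 P
    have : (D E).count P.1 = n := by
      simp only [D]
      rw [Multiset.count_map_eq_count' _ _ Subtype.val_injective, Finsupp.count_toMultiset,
        Finsupp.mapRange_apply, hE, Int.toNat_natCast]
    rw [this]
    exact ⟨hn.symm, hE⟩
  have hcard := card_eq_mul_of_count_eq_orderAt hfp hs
    (hfp.irreducible.isRelPrime_iff_not_dvd.1 h.1) hf hg (D E) (by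
      intro P hP
      obtain ⟨Q, -, rfl⟩ := Multiset.mem_map.1 hP
      exact mem_projectiveZeros_iff.1 Q.2)
    (fun P hP => (hcount ⟨P, mem_projectiveZeros_iff.2 hP⟩).1)
  rw [← hcard]
  simp only [D]
  rw [Multiset.card_map, Finsupp.card_toMultiset, CurveDiv.degree,
    Finsupp.sum_mapRange_index (fun _ => rfl), Finsupp.sum, Finsupp.sum, Nat.cast_sum]
  refine Finset.sum_congr rfl fun P _ => ?_
  rw [(hcount P).2]
  simp

end Divisors

/-! ### The adjugate of a Hermitian pencil. -/

section LinearPencil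

variable {d : ℕ} {f : RPoly} {M : Fin 3 → Matrix (Fin d) (Fin d) ℂ}

lemma linearPencil_apply (M : Fin 3 → Matrix (Fin d) (Fin d) ℂ) (j k : Fin d) :
    linearPencil M j k = ∑ i, C (M i j k) * X i := by
  simp [linearPencil, Matrix.sum_apply, mul_comm]

lemma adjugate_linearPencil_isHomogeneous (M : Fin 3 → Matrix (Fin d) (Fin d) ℂ) (j k : Fin d) :
    ((linearPencil M).adjugate j k).IsHomogeneous (d - 1) := by
  have := adjugate_isHomogeneous (A := linearPencil M) (fun j k => by
    rw [linearPencil_apply]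
    exact IsHomogeneous.sum _ _ _ fun i _ => isHomogeneous_C_mul_X _ _) j k
  rwa [Fintype.card_fin] at this

/-- Conjugating coefficients transposes a Hermitian pencil, since the variables are fixed, and the
adjugate commutes with both operations. -/
lemma IsHermitianRepresentation.conjPoly_adjugate (hM : IsHermitianRepresentation f M)
    (j k : Fin d) :
    conjPoly ((linearPencil M).adjugate j k) = (linearPencil M).adjugate k j := by
  have h : (conjPoly : CPoly →+* CPoly).mapMatrix (linearPencil M) =
      (linearPencil M).transpose := by
    ext1 j k
    rw [RingHom.mapMatrix_apply, Matrix.map_apply, Matrix.transpose_apply, linearPencil_apply,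
      linearPencil_apply, map_sum]
    refine Finset.sum_congr rfl fun i _ => ?_
    rw [← (hM.1 i).apply k j]
    simp [conjPoly_apply]
  have h2 := congrFun (congrFun
    (RingHom.map_adjugate (conjPoly : CPoly →+* CPoly) (linearPencil M)) j) k
  rw [h, ← Matrix.adjugate_transpose] at h2
  exact h2

lemma eq_zero_of_dvd_of_isHomogeneous_of_lt {f h : CPoly} {d n : ℕ} (hf : f.IsHomogeneous d)
    (hh : h.IsHomogeneous n) (hn : n < d) (hfh : f ∣ h) : h = 0 := by
  by_contra h0
  obtain ⟨c, rfl⟩ := hfh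
  have h1 := totalDegree_mul_of_isDomain (left_ne_zero_of_mul h0) (right_ne_zero_of_mul h0)
  rw [hh.totalDegree h0, hf.totalDegree (left_ne_zero_of_mul h0)] at h1
  omega

variable [NeZero d]

/-- Entries of the adjugate have degree below `d`, so those divisible by `f` are zero. If `a 0 0 =
0`, then `f` divides `a 0 j * a j 0`, so one factor vanishes, and with it its conjugate, the other.
The first row is then zero, contradicting `adj M * M = f • 1`. -/
lemma IsHermitianRepresentation.not_dvd_adjFirstRow_zero (hM : IsHermitianRepresentation f M)
    (hf : f.IsHomogeneous d) (hfp : Prime f.toComplex) :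
    ¬ f.toComplex ∣ adjFirstRow M 0 := by
  intro hdvd
  have hf' : f.toComplex.IsHomogeneous d := hf.map _
  have hlt : d - 1 < d := Nat.sub_lt (NeZero.pos d) one_pos
  have hzero : ∀ j k, f.toComplex ∣ (linearPencil M).adjugate j k →
      (linearPencil M).adjugate j k = 0 := fun j k =>
    eq_zero_of_dvd_of_isHomogeneous_of_lt hf' (adjugate_linearPencil_isHomogeneous M j k) hlt
  have hrow : ∀ j, (linearPencil M).adjugate 0 j = 0 := by
    intro j
    have h := dvd_adjugate_mul_sub (hM.2 ▸ hfp) 0 j j 0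
    rw [← hM.2, hzero 0 0 hdvd, zero_mul, sub_zero] at h
    rcases hfp.dvd_or_dvd h with h | h
    · exact hzero _ _ h
    · rw [← hM.conjPoly_adjugate, hzero _ _ h, map_zero]
  have := congrFun (congrFun (Matrix.adjugate_mul (linearPencil M)) 0) 0
  rw [← hM.2, Matrix.mul_apply] at this
  simp only [hrow, zero_mul, Finset.sum_const_zero, Matrix.smul_apply, Matrix.one_apply_eq,
    smul_eq_mul, mul_one] at this
  exact hfp.ne_zero this.symm

/-- At a point `P` of the curve, `I_P(f, a₁₁) = min_j I_P(f, a₁ⱼ) + min_j I_P(f, aⱼ₁)`. -/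
lemma IsHermitianRepresentation.orderAt_adjFirstRow_zero (hM : IsHermitianRepresentation f M)
    (hs : IsSmoothCurve f.toComplex) (hf : f.IsHomogeneous d) {P : CPlane} {t : CPoly}
    (ht : IsUniformizerAt (pointIdeal P) f.toComplex t) :
    orderAt (pointIdeal P) f.toComplex (adjFirstRow M 0) =
      (⨅ j, orderAt (pointIdeal P) f.toComplex (adjFirstRow M j)) +
        ⨅ j, orderAt (pointIdeal P) f.toComplex ((linearPencil M).adjugate j 0) := by
  set a := (linearPencil M).adjugate
  set v := orderAt (pointIdeal P) f.toComplex
  have hfv : eval P.rep (linearPencil M).det = 0 := by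
    rw [← hM.2]
    exact (mem_pointIdeal_iff_eval_rep (hf.map _)).1 ht.mem
  obtain ⟨l, hl⟩ := hs P.rep P.rep_nonzero (by rwa [hM.2])
  rw [hM.2] at hl
  obtain ⟨k, j, hkj⟩ := exists_eval_adjugate_ne_zero (linearPencil M) hfv hl
  have hunit : v (a k j) = 0 := ht.orderAt_eq_zero_iff.2 fun h =>
    hkj ((mem_pointIdeal_iff _ _).1 h _ (rep_mem_submodule P))
  have hmul : ∀ j k, v (a 0 j) + v (a k 0) = v (a 0 0) + v (a k j) := by
    have hle : ∀ {x y}, f.toComplex ∣ x - y → v y ≤ v x := fun {x y} h =>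
      ht.orderAt_le_iff.2 ⟨1, (pointIdeal P).one_notMem, 1, by simpa using h⟩
    intro j k
    have h := dvd_adjugate_mul_sub (hM.2 ▸ ht.prime) 0 j k 0
    rw [← hM.2] at h
    rw [← ht.orderAt_mul, ← ht.orderAt_mul]
    exact le_antisymm (hle (by rw [← neg_sub]; exact (dvd_neg).2 h)) (hle h)
  have hfin : v (a 0 0) ≠ ⊤ := fun h =>
    hM.not_dvd_adjFirstRow_zero hf ht.prime (ht.orderAt_eq_top_iff.1 h)
  have h0 := hmul j k
  rw [hunit, add_zero] at h0
  have hj : v (a 0 j) ≠ ⊤ := fun h => hfin (by rw [← h0, h, top_add])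
  have hk : v (a k 0) ≠ ⊤ := fun h => hfin (by rw [← h0, h, add_top])
  -- For every `i`, `v (a 0 j) + v (a k 0) = v (a 0 0) ≤ v (a 0 i) + v (a k 0)`; the finite `v (a k
  -- 0)` cancels.
  have h1 : ⨅ i, v (a 0 i) = v (a 0 j) := by
    refine le_antisymm (iInf_le _ j) (le_iInf fun i => ?_)
    refine (ENat.add_le_add_iff_right hk).1 ?_
    rw [h0, hmul i k]
    exact le_self_add
  have h2 : ⨅ i, v (a i 0) = v (a k 0) := by
    refine le_antisymm (iInf_le _ k) (le_iInf fun i => ?_)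
    refine (ENat.add_le_add_iff_left hj).1 ?_
    rw [h0, hmul j i]
    exact le_self_add
  change v (a 0 0) = (⨅ i, v (a 0 i)) + ⨅ i, v (a i 0)
  rw [h1, h2, h0]

end LinearPencil

/-! ### The divisor of the first row of the adjugate. -/

theorem mainTheorem8 (d : ℕ) [NeZero d] (f : RPoly) (hdeg : f.IsHomogeneous d)
    (hsmooth : IsSmoothCurve f.toComplex) (M : Fin 3 → Matrix (Fin d) (Fin d) ℂ)
    (hM : IsHermitianRepresentation f M) :
    ∃ D : CurveDiv f.toComplex, IsMinorDivisor f.toComplex M D ∧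
      IsRealContactDivisor f D ∧
      D.degree = ((d * (d - 1) / 2 : ℕ) : ℤ) ∧
      IsIntersectionDivisor f.toComplex (adjFirstRow M 0) (D + D.conjugate) := by
  have hdeg' : f.toComplex.IsHomogeneous d := hdeg.map _
  have hfp : Prime f.toComplex := hsmooth.prime hdeg' (NeZero.ne d)
  have hndvd := hM.not_dvd_adjFirstRow_zero hdeg hfp
  have hfin := finite_common_zeros hfp hndvd
  let m : CPlane → ℕ∞ := fun P =>
    ⨅ j, orderAt (pointIdeal P) f.toComplex (adjFirstRow M j)
  have hsum : ∀ P, f.toComplex ∈ pointIdeal P →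
      orderAt (pointIdeal P) f.toComplex (adjFirstRow M 0) = m P + m (conjPoint P) ∧
        orderAt (pointIdeal P) f.toComplex (adjFirstRow M 0) ≠ ⊤ := by
    intro P hP
    obtain ⟨t, -, ht⟩ := exists_isUniformizerAt hfp hsmooth hP
    refine ⟨?_, fun h => hndvd (ht.orderAt_eq_top_iff.1 h)⟩
    rw [hM.orderAt_adjFirstRow_zero hsmooth hdeg ht]
    congr 1
    -- The order of `a j 0` at `P` is that of its conjugate `a 0 j` at `conjPoint P`.
    refine iInf_congr fun j => ?_
    rw [← orderAt_conjPoint ht, hM.conjPoly_adjugate]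
    rfl
  have hm : ∀ P, f.toComplex ∈ pointIdeal P → ((m P).toNat : ℕ∞) = m P := fun P hP =>
    ENat.natCast_toNat fun h => (hsum P hP).2 (by rw [(hsum P hP).1, h, top_add])
  have hm0 : ∀ P, f.toComplex ∈ pointIdeal P → adjFirstRow M 0 ∉ pointIdeal P →
      m P = 0 := by
    intro P hP h
    obtain ⟨t, -, ht⟩ := exists_isUniformizerAt hfp hsmooth hP
    rw [← nonpos_iff_eq_zero, ← ht.orderAt_eq_zero_iff.2 h]
    exact iInf_le _ 0
  let D : CurveDiv f.toComplex := Finsupp.ofSupportFinite (fun P => ((m P.1).toNat : ℤ)) (by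
    refine (hfin.preimage Subtype.val_injective.injOn).subset fun P hP => ?_
    have hfP := mem_projectiveZeros_iff.1 P.2
    refine ⟨hfP, by_contra fun h => hP ?_⟩
    simp [hm0 P.1 hfP h])
  have hD : ∀ P, D P = (m P.1).toNat := fun P => rfl
  have hint : IsIntersectionDivisor f.toComplex (adjFirstRow M 0) (D + D.conjugate) := by
    refine ⟨hfp.irreducible.isRelPrime_iff_not_dvd.2 hndvd, fun P => ?_⟩
    have hP := mem_projectiveZeros_iff.1 P.2
    refine ⟨(m P.1).toNat + (m (conjPoint P.1)).toNat, ?_, ?_⟩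
    · rw [Nat.cast_add, hm _ hP, hm _ (mem_projectiveZeros_iff.1 (conjPoint_mem f P.2))]
      exact (hsum P.1 hP).1
    · rw [Finsupp.add_apply, CurveDiv.conjugate_apply, hD, hD, Nat.cast_add]
  have ha : (adjFirstRow M 0).IsHomogeneous (d - 1) := adjugate_linearPencil_isHomogeneous M 0 0
  refine ⟨D, fun P => ⟨fun _ => ?_, fun h => ?_⟩, ?_, ?_, hint⟩
  · exact ⟨_, (hm P.1 (mem_projectiveZeros_iff.1 P.2)).symm, hD P⟩
  · rw [mem_projectiveZeros_iff] at h
    rw [hD, hm0 P.1 (mem_projectiveZeros_iff.1 P.2) h]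
    rfl
  -- The diagonal entry `a₁₁` is its own conjugate, so it is itself the real form required.
  · obtain ⟨g, hg⟩ := exists_toComplex_eq (hM.conjPoly_adjugate 0 0)
    refine ⟨g, d - 1, ?_, ?_⟩
    · refine IsHomogeneous.of_map (f := algebraMap ℝ ℂ) Complex.ofReal_injective ?_
      change g.toComplex.IsHomogeneous _
      rw [hg]
      exact ha
    · rw [hg]
      exact hint
  · have h := hint.degree_eq hfp hsmooth hdeg' ha
    rw [CurveDiv.degree_add, CurveDiv.degree_conjugate] at h
    -- The natural-number division by 2 is exact because `d * (d - 1)` is even.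
    have h2 := Nat.mul_div_cancel' (Nat.even_mul_pred_self d).two_dvd
    have h3 : (2 : ℤ) * ((d * (d - 1) / 2 : ℕ) : ℤ) = ((d * (d - 1) : ℕ) : ℤ) := by
      exact_mod_cast h2
    linarith
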